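/- Let $d\ge 1$ and let $A$ be a $d\times d$ integral matrix with $|\det A|=2$ all of whose complex eigenvalues have modulus greater than $1$. Write $\vec x\circ\vec y=\sum_j x_jy_j$. Assume that $A\mathbb Z^d=A^{\tau}\mathbb Z^d$, where $A^\tau$ is the transpose of $A$, and that $\vec\ell_A,\vec q_A\in\mathbb Z^d$ are vectors such that $$\mathbb Z^d=(\vec\ell_A+A\mathbb Z^d)\,\dot\cup\,A\mathbb Z^d\ \text{ (disjoint union)},\qquad \vec q_A\circ A\mathbb Z^d\subseteq 2\mathbb Z,\qquad \vec q_A\circ(\vec\ell_A+A\mathbb Z^d)\subseteq 2\mathbb Z+1 .$$ Let $(h_{\vec n})_{\vec n\in\mathbb Z^d}$ be complex numbers, all but finitely many equal to $0$, with $$\sum_{\vec n\in\mathbb Z^d}h_{\vec n}\overline{h_{\vec n+\vec k}}=\delta_{\vec 0\,\vec k}\quad(\vec k\in A\mathbb Z^d),\qquad \sum_{\vec n\in\mathbb Z^d}h_{\vec n}=\sqrt2 .$$ Put $m_0(\vec t)=\frac1{\sqrt2}\sum_{\vec n\in\mathbb Z^d}h_{\vec n}e^{-i\vec n\circ\vec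 t}$ and $$g(\vec\xi)=\frac1{(2\pi)^{d/2}}\prod_{j=1}^{\infty}m_0\big((A^\tau)^{-j}\vec\xi\big),\qquad \vec\xi\in\mathbb R^d .$$ Then the product converges (unconditionally) for every $\vec\xi\in\mathbb R^d$ and $g\in L^2(\mathbb R^d)$. Let $\varphi=\mathcal F^{-1}g\in L^2(\mathbb R^d)$, where $\mathcal F$ is the unitary extension to $L^2(\mathbb R^d)$ of $(\mathcal Ff)(\vec s)=(2\pi)^{-d/2}\int_{\mathbb R^d}e^{-i\vec s\circ\vec t}f(\vec t)\,d\vec t$. On $L^2(\mathbb R^d)$ let $(T_{\vec\ell}f)(\vec t)=f(\vec t-\vec\ell)$ and $(D_Af)(\vec t)=\sqrt{|\det A|}\,f(A\vec t)$, and put $$\psi=\sum_{\vec n\in\mathbb Z^d}(-1)^{\vec q_A\circ\vec n}\,\overline{h_{\vec\ell_A-\vec n}}\,D_AT_{\vec n}\varphi .$$ Then $\{D_A^nT_{\vec\ell}\psi:\ n\in\mathbb Z,\ \vec\ell\in\mathbb Z^d\}$ is a Parseval's frame (normalized tight frame) of $L^2(\mathbb R^d)$, that is, $$\sum_{n\in\mathbb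 Z,\ \vec\ell\in\mathbb Z^d}|\langle f,D_A^nT_{\vec\ell}\psi\rangle|^2=\|f\|^2\qquad\text{for all } f\in L^2(\mathbb R^d).$$ -/

import Mathlib

open MeasureTheory

noncomputable section

namespace Wavelet

/-- The Hilbert space `L²(ℝ^d)` of square integrable complex valued functions. -/
abbrev L2 (d : ℕ) : Type := Lp (α := EuclideanSpace ℝ (Fin d)) ℂ 2

/-! ### Lattice vectors and matrices -/

/-- The inclusion `ℤ^d ⊆ ℝ^d`. -/
def latticePoint {d : ℕ} (n : Fin d → ℤ) : EuclideanSpace ℝ (Fin d) :=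
  WithLp.toLp 2 fun i => (n i : ℝ)

/-- An integral matrix regarded as a real matrix. -/
def realMat {d : ℕ} (A : Matrix (Fin d) (Fin d) ℤ) : Matrix (Fin d) (Fin d) ℝ :=
  A.map fun z => (z : ℝ)

/-- The subset `A ℤ^d` of `ℤ^d`. -/
def imageLattice {d : ℕ} (A : Matrix (Fin d) (Fin d) ℤ) : Set (Fin d → ℤ) :=
  Set.range fun k : Fin d → ℤ => A.mulVec k

/-- `A` is expansive: every (complex) eigenvalue of `A` has modulus greater than one. -/
def IsExpansive {d : ℕ} (A : Matrix (Fin d) (Fin d) ℤ) : Prop :=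
  ∀ β ∈ spectrum ℂ (A.map fun z => (z : ℂ)), 1 < ‖β‖

/-- The partition properties of an integral matrix `A` with vectors `ℓ, q ∈ ℤ^d`. -/
structure PartitionProperties {d : ℕ} (A : Matrix (Fin d) (Fin d) ℤ) (ℓ q : Fin d → ℤ) :
    Prop where
  /-- `A ℤ^d = A^τ ℤ^d` -/
  image_transpose : imageLattice A = imageLattice A.transpose
  /-- `ℤ^d = (ℓ + A ℤ^d) ∪ A ℤ^d` -/
  union_eq : (fun x => ℓ + x) '' imageLattice A ∪ imageLattice A = Set.univ
  /-- the above union is disjoint -/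
  disjoint : Disjoint ((fun x => ℓ + x) '' imageLattice A) (imageLattice A)
  /-- `q ∘ A ℤ^d ⊆ 2ℤ` -/
  even_dot : ∀ x ∈ imageLattice A, Even (q ⬝ᵥ x)
  /-- `q ∘ (ℓ + A ℤ^d) ⊆ 2ℤ + 1` -/
  odd_dot : ∀ x ∈ (fun x => ℓ + x) '' imageLattice A, Odd (q ⬝ᵥ x)

/-- `h` is a finite solution of Lawton's system of equations associated with `A`. -/
structure IsFiniteLawtonSolution {d : ℕ} (A : Matrix (Fin d) (Fin d) ℤ)
    (h : (Fin d → ℤ) → ℂ) : Prop where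
  finite_support : (Function.support h).Finite
  orthogonality : ∀ k ∈ imageLattice A,
    ∑ᶠ n, h n * (starRingEnd ℂ) (h (n + k)) = if k = 0 then 1 else 0
  normalization : ∑ᶠ n, h n = (Real.sqrt 2 : ℂ)

/-! ### Unitary operators on `L²(ℝ^d)` -/

theorem map_toEuclideanLin {d : ℕ} (M : Matrix (Fin d) (Fin d) ℝ) (hM : M.det ≠ 0) :
    Measure.map (Matrix.toEuclideanLin M) (volume : Measure (EuclideanSpace ℝ (Fin d))) =
      ENNReal.ofReal |(M.det)⁻¹| • volume := by
  have hdet : LinearMap.det (Matrix.toEuclideanLin M) = M.det := by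
    rw [Matrix.toEuclideanLin_eq_toLin_orthonormal, LinearMap.det_toLin]
  have := Measure.map_linearMap_addHaar_eq_smul_addHaar
    (volume : Measure (EuclideanSpace ℝ (Fin d))) (f := Matrix.toEuclideanLin M)
    (by rwa [hdet])
  rwa [hdet] at this

theorem measurable_toEuclideanLin {d : ℕ} (M : Matrix (Fin d) (Fin d) ℝ) :
    Measurable (Matrix.toEuclideanLin M) :=
  (LinearMap.continuous_of_finiteDimensional _).measurable

theorem quasiMeasurePreserving_toEuclideanLin {d : ℕ} (M : Matrix (Fin d) (Fin d) ℝ)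
    (hM : M.det ≠ 0) :
    Measure.QuasiMeasurePreserving (Matrix.toEuclideanLin M)
      (volume : Measure (EuclideanSpace ℝ (Fin d))) volume :=
  ⟨measurable_toEuclideanLin M, by
    rw [map_toEuclideanLin M hM]; exact Measure.smul_absolutelyContinuous⟩

/-- The function `t ↦ √|det M| f(Mt)`. -/
def dilationFun {d : ℕ} (M : Matrix (Fin d) (Fin d) ℝ) (f : EuclideanSpace ℝ (Fin d) → ℂ) :
    EuclideanSpace ℝ (Fin d) → ℂ :=
  fun t => (Real.sqrt |M.det| : ℂ) * f (Matrix.toEuclideanLin M t)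

theorem memLp_dilationFun {d : ℕ} (M : Matrix (Fin d) (Fin d) ℝ) (hM : M.det ≠ 0)
    {f : EuclideanSpace ℝ (Fin d) → ℂ} (hf : MemLp f 2) : MemLp (dilationFun M f) 2 := by
  refine MemLp.const_mul (MemLp.comp_of_map ?_ (measurable_toEuclideanLin M).aemeasurable) _
  rw [map_toEuclideanLin M hM]
  exact hf.smul_measure ENNReal.ofReal_ne_top

theorem eLpNorm_dilationFun {d : ℕ} (M : Matrix (Fin d) (Fin d) ℝ) (hM : M.det ≠ 0)
    {f : EuclideanSpace ℝ (Fin d) → ℂ} (hf : MemLp f 2) :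
    eLpNorm (dilationFun M f) 2 volume = eLpNorm f 2 volume := by
  have h1 : eLpNorm (fun t => f (Matrix.toEuclideanLin M t)) 2 volume =
      eLpNorm f 2 (Measure.map (Matrix.toEuclideanLin M) volume) := by
    symm
    refine eLpNorm_map_measure ?_ (measurable_toEuclideanLin M).aemeasurable
    rw [map_toEuclideanLin M hM]
    exact (hf.smul_measure ENNReal.ofReal_ne_top).aestronglyMeasurable
  have h2 : dilationFun M f =
      (Real.sqrt |M.det| : ℂ) • fun t => f (Matrix.toEuclideanLin M t) := rfl
  have hpos : 0 < |M.det| := abs_pos.mpr hM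
  rw [h2, eLpNorm_const_smul, h1, map_toEuclideanLin M hM,
    eLpNorm_smul_measure_of_ne_top (by simp), smul_eq_mul, ← mul_assoc]
  have h3 : ‖(Real.sqrt |M.det| : ℂ)‖ₑ = ENNReal.ofReal (Real.sqrt |M.det|) := by
    rw [← ofReal_norm, Complex.norm_real, Real.norm_of_nonneg (Real.sqrt_nonneg _)]
  have h4 : (ENNReal.ofReal |(M.det)⁻¹|) ^ (1 / (2 : ENNReal)).toReal =
      ENNReal.ofReal (Real.sqrt |M.det|)⁻¹ := by
    rw [ENNReal.ofReal_rpow_of_nonneg (abs_nonneg _) (by positivity), abs_inv,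
      ← Real.sqrt_inv, Real.sqrt_eq_rpow]
    norm_num
  rw [h3, h4, ← ENNReal.ofReal_mul (Real.sqrt_nonneg _),
    mul_inv_cancel₀ (Real.sqrt_pos.mpr hpos).ne', ENNReal.ofReal_one, one_mul]

theorem dilationFun_congr {d : ℕ} (M : Matrix (Fin d) (Fin d) ℝ) (hM : M.det ≠ 0)
    {f g : EuclideanSpace ℝ (Fin d) → ℂ} (h : f =ᵐ[volume] g) :
    dilationFun M f =ᵐ[volume] dilationFun M g := by
  filter_upwards [(quasiMeasurePreserving_toEuclideanLin M hM).ae h] with t ht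
  simp only [dilationFun, ht]

theorem dilationFun_comp {d : ℕ} (M N : Matrix (Fin d) (Fin d) ℝ) (h : N * M = 1)
    (f : EuclideanSpace ℝ (Fin d) → ℂ) : dilationFun M (dilationFun N f) = f := by
  have hd : |M.det| * |N.det| = 1 := by
    rw [← abs_mul, mul_comm, ← Matrix.det_mul, h, Matrix.det_one, abs_one]
  funext t
  have ht : Matrix.toEuclideanLin N (Matrix.toEuclideanLin M t) = t := by
    simp [Matrix.toLpLin_apply, h]
  simp only [dilationFun, ht]
  rw [← mul_assoc, ← Complex.ofReal_mul, ← Real.sqrt_mul (abs_nonneg _), hd]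
  simp

/-- The unitary operator `(U_M f)(t) = √|det M| f(Mt)` on `L²(ℝ^d)`, for an invertible real
matrix `M`. -/
def unitaryDilation {d : ℕ} (M : Matrix (Fin d) (Fin d) ℝ) (hM : M.det ≠ 0) :
    L2 d ≃ₗᵢ[ℂ] L2 d where
  toFun f := (memLp_dilationFun M hM (Lp.memLp f)).toLp (dilationFun M f)
  invFun f := (memLp_dilationFun M⁻¹ (by simpa [Matrix.det_nonsing_inv] using hM)
    (Lp.memLp f)).toLp (dilationFun M⁻¹ f)
  map_add' f g := by
    rw [← MemLp.toLp_add, MemLp.toLp_eq_toLp_iff]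
    refine (dilationFun_congr M hM (Lp.coeFn_add f g)).trans (Filter.Eventually.of_forall ?_)
    intro t
    simp [dilationFun, mul_add]
  map_smul' c f := by
    rw [RingHom.id_apply, ← MemLp.toLp_const_smul, MemLp.toLp_eq_toLp_iff]
    refine (dilationFun_congr M hM (Lp.coeFn_smul c f)).trans (Filter.Eventually.of_forall ?_)
    intro t
    simp [dilationFun, mul_left_comm]
  left_inv f := by
    have hM' : M⁻¹.det ≠ 0 := by simpa [Matrix.det_nonsing_inv] using hM
    refine Lp.ext ((MemLp.coeFn_toLp _).trans
      ((dilationFun_congr M⁻¹ hM' (MemLp.coeFn_toLp _)).trans ?_))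
    rw [dilationFun_comp M⁻¹ M (Matrix.mul_nonsing_inv M (isUnit_iff_ne_zero.mpr hM))]
  right_inv f := by
    refine Lp.ext ((MemLp.coeFn_toLp _).trans
      ((dilationFun_congr M hM (MemLp.coeFn_toLp _)).trans ?_))
    rw [dilationFun_comp M M⁻¹ (Matrix.nonsing_inv_mul M (isUnit_iff_ne_zero.mpr hM))]
  norm_map' f := by
    change ‖(memLp_dilationFun M hM (Lp.memLp f)).toLp (dilationFun M f)‖ = ‖f‖
    rw [Lp.norm_toLp, eLpNorm_dilationFun M hM (Lp.memLp f), Lp.norm_def]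

/-- The translation operator `(T_x f)(t) = f(t - x)` on `L²(ℝ^d)`. -/
def translation {d : ℕ} (x : EuclideanSpace ℝ (Fin d)) : L2 d →ₗᵢ[ℂ] L2 d :=
  Lp.compMeasurePreservingₗᵢ ℂ (fun t => t - x) (measurePreserving_sub_right volume x)

theorem det_realMat_ne_zero {d : ℕ} {A : Matrix (Fin d) (Fin d) ℤ} (hA : |A.det| = 2) :
    (realMat A).det ≠ 0 := by
  have h : (realMat A).det = (A.det : ℝ) := (Int.cast_det A).symm
  rw [h]
  intro h0
  rw [Int.cast_eq_zero.mp h0] at hA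
  norm_num at hA

/-- The dilation operator `D_A = U_A` associated with an integral matrix `A` with `|det A| = 2`. -/
def dilation {d : ℕ} (A : Matrix (Fin d) (Fin d) ℤ) (hA : |A.det| = 2) : L2 d ≃ₗᵢ[ℂ] L2 d :=
  unitaryDilation (realMat A) (det_realMat_ne_zero hA)

theorem det_scaling_ne_zero (d : ℕ) :
    (((2 * Real.pi)⁻¹ : ℝ) • (1 : Matrix (Fin d) (Fin d) ℝ)).det ≠ 0 := by
  rw [Matrix.det_smul, Matrix.det_one, mul_one]
  exact pow_ne_zero _ (inv_ne_zero (by positivity))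

/-- The Fourier-Plancherel transform `(F f)(s) = (2π)^{-d/2} ∫ e^{-i s∘t} f(t) dt` (extended from
`L¹ ∩ L²` to `L²`). Mathlib's transform `𝓕` uses the kernel `e^{-2πi s∘t}` and no factor in front,
so that `(F f)(s) = (2π)^{-d/2} (𝓕 f)(s / 2π)`, which is `U_M (𝓕 f)` for `M = (2π)⁻¹ I`. -/
def fourierPlancherel (d : ℕ) : L2 d ≃ₗᵢ[ℂ] L2 d :=
  (Lp.fourierTransformₗᵢ (EuclideanSpace ℝ (Fin d)) ℂ).trans
    (unitaryDilation (((2 * Real.pi)⁻¹ : ℝ) • 1) (det_scaling_ne_zero d))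

/-- `ψ` is a Parseval's frame wavelet associated with `A`: the family `D_A^n T_ℓ ψ`, `n ∈ ℤ`,
`ℓ ∈ ℤ^d`, is a normalized tight frame of `L²(ℝ^d)`. -/
def IsParsevalFrameWavelet {d : ℕ} (A : Matrix (Fin d) (Fin d) ℤ) (hA : |A.det| = 2)
    (ψ : L2 d) : Prop :=
  ∀ f : L2 d, HasSum
    (fun p : ℤ × (Fin d → ℤ) =>
      ‖inner ℂ ((dilation A hA ^ p.1) (translation (latticePoint p.2) ψ)) f‖ ^ 2)
    (‖f‖ ^ 2)

/-! ### Filter, scaling function and wavelet -/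

/-- The filter `m₀(t) = (1/√2) ∑ₙ hₙ e^{-i n∘t}`. -/
def filterFun {d : ℕ} (h : (Fin d → ℤ) → ℂ) (t : EuclideanSpace ℝ (Fin d)) : ℂ :=
  (1 / (Real.sqrt 2 : ℂ)) *
    ∑ᶠ n, h n * Complex.exp (-Complex.I * ((∑ i, (n i : ℝ) * t i : ℝ) : ℂ))

/-- The factor `m₀((A^τ)^{-(j+1)} ξ)`, `j = 0, 1, 2, …`. -/
def productFactor {d : ℕ} (A : Matrix (Fin d) (Fin d) ℤ) (h : (Fin d → ℤ) → ℂ)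
    (ξ : EuclideanSpace ℝ (Fin d)) (j : ℕ) : ℂ :=
  filterFun h (Matrix.toEuclideanLin (((realMat A).transpose)⁻¹ ^ (j + 1)) ξ)

/-- `g(ξ) = (2π)^{-d/2} ∏_{j ≥ 1} m₀((A^τ)^{-j} ξ)`. -/
def scalingSymbol {d : ℕ} (A : Matrix (Fin d) (Fin d) ℤ) (h : (Fin d → ℤ) → ℂ)
    (ξ : EuclideanSpace ℝ (Fin d)) : ℂ :=
  (((2 * Real.pi) ^ (-(d : ℝ) / 2) : ℝ) : ℂ) * ∏' j : ℕ, productFactor A h ξ j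

/-- The scaling function `φ = F⁻¹ g`. -/
def scalingFunction {d : ℕ} (A : Matrix (Fin d) (Fin d) ℤ) (h : (Fin d → ℤ) → ℂ)
    (hg : MemLp (scalingSymbol A h) 2 volume) : L2 d :=
  (fourierPlancherel d).symm (hg.toLp (scalingSymbol A h))

/-- `ψ = ∑ₙ (-1)^{q∘n} conj(h_{ℓ-n}) D_A Tₙ φ`. -/
def waveletOf {d : ℕ} (A : Matrix (Fin d) (Fin d) ℤ) (hA : |A.det| = 2) (ℓ q : Fin d → ℤ)
    (h : (Fin d → ℤ) → ℂ) (φ : L2 d) : L2 d :=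
  ∑ᶠ n : Fin d → ℤ, ((-1 : ℂ) ^ (q ⬝ᵥ n) * (starRingEnd ℂ) (h (ℓ - n))) •
    dilation A hA (translation (latticePoint n) φ)

end Wavelet

end

namespace Wavelet

open scoped ComplexConjugate FourierTransform SchwartzMap
open Filter Topology

section FilterBank

variable {G : Type*} [AddCommGroup G]

/-- `χ` is the quadratic character of `G` whose kernel is the range of the injective
endomorphism `α`. -/
structure IsIndexTwoCharacter (α : G →+ G) (χ : G → ℂ) : Prop where
  injective : Function.Injective α
  map_add : ∀ a b, χ (a + b) = χ a * χ b
  map_range : ∀ a ∈ Set.range α, χ a = 1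
  map_compl : ∀ a ∉ Set.range α, χ a = -1

/-- `h` is supported in `S` and satisfies Lawton's orthogonality relations along the range
of `α`. -/
structure IsLawtonFilter (α : G →+ G) (S : Finset G) (h : G → ℂ) : Prop where
  support : ∀ n ∉ S, h n = 0
  orthogonality : ∀ k ∈ Set.range α, ∑ n ∈ S, h n * conj (h (n + k)) = Set.indicator {0} 1 k

namespace IsIndexTwoCharacter

variable {α : G →+ G} {χ : G → ℂ} (hχ : IsIndexTwoCharacter α χ)
include hχ

theorem eq_or (a : G) : χ a = 1 ∨ χ a = -1 := by
  by_cases ha : a ∈ Set.range α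
  · exact .inl (hχ.map_range a ha)
  · exact .inr (hχ.map_compl a ha)

theorem mul_self (a : G) : χ a * χ a = 1 := by
  rcases hχ.eq_or a with h | h <;> simp [h]

theorem map_zero : χ 0 = 1 := hχ.map_range 0 ⟨0, by simp⟩

theorem map_neg (a : G) : χ (-a) = χ a := by
  have h1 := hχ.map_add (-a) a
  rw [neg_add_cancel, hχ.map_zero] at h1
  have h2 := hχ.mul_self a
  calc χ (-a) = χ (-a) * (χ a * χ a) := by rw [h2, mul_one]
    _ = χ (-a) * χ a * χ a := by ring
    _ = χ a := by rw [← h1, one_mul]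

theorem map_sub (a b : G) : χ (a - b) = χ a * χ b := by
  rw [sub_eq_add_neg, hχ.map_add, hχ.map_neg]

theorem conj_eq (a : G) : conj (χ a) = χ a := by
  rcases hχ.eq_or a with h | h <;> simp [h]

/-- Summation over a coset of the range of `α`. -/
theorem hasSum_coset {F : G → ℂ} (hF : Summable F) (n : G) :
    HasSum (fun k => F (n + α k)) (∑' p, (1 + χ p * χ n) / 2 * F p) := by
  have hinj : Function.Injective fun k => n + α k := fun a b hab =>
    hχ.injective (add_left_cancel hab)
  have hs : Summable fun p => (1 + χ p * χ n) / 2 * F p := by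
    refine Summable.of_norm_bounded hF.norm fun p => ?_
    rw [norm_mul]
    refine mul_le_of_le_one_left (norm_nonneg _) ?_
    rcases hχ.eq_or p with h | h <;> rcases hχ.eq_or n with h' | h' <;> simp [h, h']
  have := (hinj.hasSum_iff (f := fun p => (1 + χ p * χ n) / 2 * F p) ?_).mpr hs.hasSum
  · refine this.congr_fun fun k => ?_
    have h1 := hχ.map_range (α k) ⟨k, rfl⟩
    simp only [Function.comp, hχ.map_add, h1, mul_one, hχ.mul_self]
    ring
  · intro p hp
    have : p - n ∉ Set.range α := fun ⟨k, hk⟩ => hp ⟨k, by simp [hk]⟩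
    have := hχ.map_compl _ this
    rw [hχ.map_sub] at this
    simp [this]

/-- The autocorrelation identity behind both the quadrature mirror condition and the perfect
reconstruction property. -/
theorem sum_autocorrelation {S : Finset G} {h : G → ℂ} (hh : IsLawtonFilter α S h) (X : G → ℂ) :
    ∑ m ∈ S, ∑ n ∈ S, conj (h m) * h n * ((1 + χ m * χ n) / 2 * X (m - n)) = X 0 := by
  classical
  set U : Finset G := insert 0 ((S ×ˢ S).image fun p => p.1 - p.2) with hU
  have key : ∀ n ∈ S, ∑ m ∈ S, conj (h m) * h n * ((1 + χ m * χ n) / 2 * X (m - n)) =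
      ∑ u ∈ U, (1 + χ u) / 2 * X u * (h n * conj (h (n + u))) := by
    intro n hn
    have hinj : Set.InjOn (fun m => m - n) (S : Set G) := fun a _ b _ hab => by simpa using hab
    refine Finset.sum_of_injOn (fun m => m - n) hinj ?_ ?_ ?_
    · intro m hm
      simp only [hU, Finset.coe_insert, Set.mem_insert_iff, Finset.mem_coe, Finset.mem_image,
        Finset.mem_product]
      exact .inr ⟨(m, n), ⟨hm, hn⟩, rfl⟩
    · intro u _ hu
      have : h (n + u) = 0 := hh.support _ fun hS => hu ⟨n + u, hS, by simp⟩
      simp [this]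
    · intro m _
      simp only [add_sub_cancel, hχ.map_sub]
      ring
  rw [Finset.sum_comm, Finset.sum_congr rfl key, Finset.sum_comm]
  simp_rw [← Finset.mul_sum]
  rw [Finset.sum_eq_single 0]
  · rw [hh.orthogonality 0 ⟨0, by simp⟩, hχ.map_zero]
    simp
  · intro u _ hu
    by_cases hr : u ∈ Set.range α
    · rw [hh.orthogonality u hr, Set.indicator_of_notMem (by simpa using hu), mul_zero]
    · simp [hχ.map_compl u hr]
  · intro h0
    exact absurd (Finset.mem_insert_self _ _) h0

/-- Perfect reconstruction: the two-channel filter bank of a Lawton filter is isometric on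
square summable sequences. -/
theorem hasSum_filterBank {S : Finset G} {h : G → ℂ} (hh : IsLawtonFilter α S h) {ℓ : G}
    (hℓ : ℓ ∉ Set.range α) {c : G → ℂ} (hc : Summable fun n => ‖c n‖ ^ 2) :
    HasSum (fun k => ‖∑ n ∈ S, conj (h n) * c (n + α k)‖ ^ 2 +
      ‖∑ n ∈ S, χ (ℓ - n) * h n * c (ℓ - n + α k)‖ ^ 2) (∑' n, ‖c n‖ ^ 2) := by
  have hX : ∀ u, Summable fun p => c (p + u) * conj (c p) := by
    intro u
    have h1 : Summable fun p => ‖c (p + u)‖ ^ 2 :=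
      (Equiv.addRight u).summable_iff (f := fun n => ‖c n‖ ^ 2) |>.mpr hc
    refine Summable.of_norm_bounded (h1.add hc) fun p => ?_
    rw [norm_mul, RCLike.norm_conj]
    nlinarith [sq_nonneg (‖c (p + u)‖ - ‖c p‖), sq_nonneg (‖c (p + u)‖), sq_nonneg (‖c p‖)]
  have e1 : ∀ m n, HasSum (fun k => c (m + α k) * conj (c (n + α k)))
      (∑' p, (1 + χ p * χ n) / 2 * (c (p + (m - n)) * conj (c p))) := by
    intro m n
    refine (hχ.hasSum_coset (hX (m - n)) n).congr_fun fun k => ?_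
    rw [show n + α k + (m - n) = m + α k by abel]
  have hs : ∀ (u : G) (w : G → ℂ), (∀ p, ‖w p‖ ≤ 1) →
      Summable fun p => w p * (c (p + u) * conj (c p)) := by
    intro u w hw
    refine Summable.of_norm_bounded (hX u).norm fun p => ?_
    rw [norm_mul]
    exact mul_le_of_le_one_left (norm_nonneg _) (hw p)
  have hχℓ := hχ.map_compl ℓ hℓ
  have e2 : ∀ m n, HasSum (fun k => c (m + α k) * conj (c (n + α k)) +
      χ m * χ n * (c (ℓ - n + α k) * conj (c (ℓ - m + α k))))
      ((1 + χ m * χ n) / 2 * ∑' p, c (p + (m - n)) * conj (c p)) := by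
    intro m n
    convert (e1 m n).add ((e1 (ℓ - n) (ℓ - m)).mul_left (χ m * χ n)) using 1
    rw [← tsum_mul_left, ← tsum_mul_left, ← Summable.tsum_add]
    · refine tsum_congr fun p => ?_
      rw [show ℓ - n - (ℓ - m) = m - n by abel, hχ.map_sub, hχℓ]
      have := hχ.mul_self m
      linear_combination (χ p * χ n * (c (p + (m - n)) * conj (c p)) / 2) * this
    · refine hs _ _ fun p => ?_
      rcases hχ.eq_or p with h | h <;> rcases hχ.eq_or n with h' | h' <;> simp [h, h']
    · refine Summable.mul_left _ (hs _ _ fun p => ?_)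
      rcases hχ.eq_or p with h | h <;> rcases hχ.eq_or (ℓ - m) with h' | h' <;> simp [h, h']
  have e3 : HasSum (fun k => ∑ m ∈ S, ∑ n ∈ S, conj (h m) * h n *
      (c (m + α k) * conj (c (n + α k)) +
        χ m * χ n * (c (ℓ - n + α k) * conj (c (ℓ - m + α k)))))
      (∑' p, c p * conj (c p)) := by
    have := hχ.sum_autocorrelation hh fun u => ∑' p, c (p + u) * conj (c p)
    simp only [add_zero] at this
    rw [← this]
    exact hasSum_sum fun m _ => hasSum_sum fun n _ => (e2 m n).mul_left _
  rw [← Complex.hasSum_ofReal, Complex.ofReal_tsum]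
  have e4 : ∀ z : ℂ, ((‖z‖ ^ 2 : ℝ) : ℂ) = z * conj z := fun z => by
    rw [Complex.mul_conj, Complex.normSq_eq_norm_sq]
  simp only [Complex.ofReal_add, e4]
  refine e3.congr_fun fun k => ?_
  rw [map_sum, map_sum, Finset.sum_mul_sum, Finset.sum_mul_sum]
  rw [Finset.sum_comm (f := fun i j => χ (ℓ - i) * h i * c (ℓ - i + α k) *
    conj (χ (ℓ - j) * h j * c (ℓ - j + α k))), ← Finset.sum_add_distrib]
  refine Finset.sum_congr rfl fun m _ => ?_
  rw [← Finset.sum_add_distrib]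
  refine Finset.sum_congr rfl fun n _ => ?_
  simp only [map_mul, Complex.conj_conj, hχ.conj_eq, hχ.map_sub, hχℓ, _root_.map_neg, map_one]
  ring

end IsIndexTwoCharacter

end FilterBank

section Hilbert

set_option linter.unusedSectionVars false

variable {G H : Type*} [AddCommGroup G] [NormedAddCommGroup H] [InnerProductSpace ℂ H]

/-- A dilation and a family of translations with `T_k D = D T_{α k}`. -/
structure IsDilationSystem (α : G →+ G) (D : H ≃ₗᵢ[ℂ] H) (T : G → H →ₗᵢ[ℂ] H) : Prop where
  zero_apply : ∀ f, T 0 f = f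
  add_apply : ∀ a b f, T (a + b) f = T a (T b f)
  comm : ∀ k f, T k (D f) = D (T (α k) f)

/-- The translates of `φ` form a Bessel sequence with bound one. -/
def IsBesselOne (T : G → H →ₗᵢ[ℂ] H) (φ : H) : Prop :=
  ∀ (f : H) (F : Finset G), ∑ k ∈ F, ‖inner ℂ (T k φ) f‖ ^ 2 ≤ ‖f‖ ^ 2

/-- The refinement operator `φ ↦ ∑ₙ hₙ D Tₙ φ`. -/
noncomputable def refine (S : Finset G) (h : G → ℂ) (D : H ≃ₗᵢ[ℂ] H) (T : G → H →ₗᵢ[ℂ] H) (φ : H) : H :=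
  ∑ n ∈ S, h n • D (T n φ)

/-- The detail generator `∑ₙ χ(ℓ - n) conj(hₙ) D T_{ℓ - n} φ`. -/
noncomputable def detail (S : Finset G) (h χ : G → ℂ) (ℓ : G) (D : H ≃ₗᵢ[ℂ] H) (T : G → H →ₗᵢ[ℂ] H) (φ : H) : H :=
  ∑ n ∈ S, (χ (ℓ - n) * conj (h n)) • D (T (ℓ - n) φ)

variable {α : G →+ G} {D : H ≃ₗᵢ[ℂ] H} {T : G → H →ₗᵢ[ℂ] H}

theorem IsBesselOne.summable {φ : H} (hφ : IsBesselOne T φ) (f : H) :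
    Summable fun k => ‖inner ℂ (T k φ) f‖ ^ 2 :=
  summable_of_sum_le (fun _ => by positivity) (hφ f)

theorem IsBesselOne.tsum_le {φ : H} (hφ : IsBesselOne T φ) (f : H) :
    ∑' k, ‖inner ℂ (T k φ) f‖ ^ 2 ≤ ‖f‖ ^ 2 :=
  (hφ.summable f).tsum_le_of_sum_le (hφ f)

theorem inner_dilation (D : H ≃ₗᵢ[ℂ] H) (u f : H) : inner ℂ (D u) f = inner ℂ u (D.symm f) := by
  conv_lhs => rw [← D.apply_symm_apply f]
  exact D.inner_map_map _ _

theorem inner_dilation_zpow (D : H ≃ₗᵢ[ℂ] H) (n : ℤ) (u f : H) :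
    inner ℂ ((D ^ n) u) f = inner ℂ u ((D ^ (-n)) f) := by
  rw [inner_dilation, zpow_neg]
  rfl

theorem IsDilationSystem.inner_refine (hT : IsDilationSystem α D T) (S : Finset G) (h : G → ℂ)
    (φ f : H) (k : G) : inner ℂ (T k (refine S h D T φ)) f =
      ∑ n ∈ S, conj (h n) * inner ℂ (T (n + α k) φ) (D.symm f) := by
  simp only [refine, map_sum, map_smul, sum_inner, inner_smul_left, hT.comm, ← hT.add_apply,
    inner_dilation, add_comm]

theorem IsDilationSystem.inner_detail (hT : IsDilationSystem α D T) {χ : G → ℂ}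
    (hχ : IsIndexTwoCharacter α χ) (S : Finset G) (h : G → ℂ) (ℓ : G)
    (φ f : H) (k : G) : inner ℂ (T k (detail S h χ ℓ D T φ)) f =
      ∑ n ∈ S, χ (ℓ - n) * h n * inner ℂ (T (ℓ - n + α k) φ) (D.symm f) := by
  simp only [detail, map_sum, map_smul, sum_inner, inner_smul_left, hT.comm, ← hT.add_apply,
    inner_dilation, map_mul, hχ.conj_eq, Complex.conj_conj, add_comm]

variable {χ : G → ℂ} {S : Finset G} {h : G → ℂ} {ℓ : G}

theorem IsDilationSystem.hasSum_refine_add_detail (hT : IsDilationSystem α D T)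
    (hχ : IsIndexTwoCharacter α χ) (hh : IsLawtonFilter α S h) (hℓ : ℓ ∉ Set.range α) {φ : H}
    (hφ : IsBesselOne T φ) (f : H) :
    HasSum (fun k => ‖inner ℂ (T k (refine S h D T φ)) f‖ ^ 2 +
      ‖inner ℂ (T k (detail S h χ ℓ D T φ)) f‖ ^ 2)
      (∑' k, ‖inner ℂ (T k φ) (D.symm f)‖ ^ 2) := by
  simp only [hT.inner_refine, hT.inner_detail hχ]
  exact hχ.hasSum_filterBank hh hℓ (c := fun k => inner ℂ (T k φ) (D.symm f)) (hφ.summable _)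

theorem IsDilationSystem.isBesselOne_refine (hT : IsDilationSystem α D T)
    (hχ : IsIndexTwoCharacter α χ) (hh : IsLawtonFilter α S h) (hℓ : ℓ ∉ Set.range α) {φ : H}
    (hφ : IsBesselOne T φ) : IsBesselOne T (refine S h D T φ) := by
  intro f F
  have hs := hT.hasSum_refine_add_detail hχ hh hℓ hφ f
  calc ∑ k ∈ F, ‖inner ℂ (T k (refine S h D T φ)) f‖ ^ 2
      ≤ ∑ k ∈ F, (‖inner ℂ (T k (refine S h D T φ)) f‖ ^ 2 +
        ‖inner ℂ (T k (detail S h χ ℓ D T φ)) f‖ ^ 2) :=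
        Finset.sum_le_sum fun k _ => le_add_of_nonneg_right (by positivity)
    _ ≤ ∑' k, ‖inner ℂ (T k φ) (D.symm f)‖ ^ 2 :=
        sum_le_hasSum _ (fun _ _ => by positivity) hs
    _ ≤ ‖D.symm f‖ ^ 2 := hφ.tsum_le _
    _ = ‖f‖ ^ 2 := by rw [D.symm.norm_map]

theorem IsDilationSystem.hasSum_detail (hT : IsDilationSystem α D T)
    (hχ : IsIndexTwoCharacter α χ) (hh : IsLawtonFilter α S h) (hℓ : ℓ ∉ Set.range α) {φ : H}
    (hφ : IsBesselOne T φ) (hr : refine S h D T φ = φ) (f : H) :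
    HasSum (fun k => ‖inner ℂ (T k (detail S h χ ℓ D T φ)) f‖ ^ 2)
      (∑' k, ‖inner ℂ (T k φ) (D.symm f)‖ ^ 2 - ∑' k, ‖inner ℂ (T k φ) f‖ ^ 2) := by
  have hs := hT.hasSum_refine_add_detail hχ hh hℓ hφ f
  rw [hr] at hs
  simpa using hs.sub (hφ.summable f).hasSum

/-- A telescoping series over `ℤ` of nonnegative terms. -/
theorem hasSum_int_telescope {p : ℤ → ℝ} (hp : ∀ n, p n ≤ p (n + 1)) {a b : ℝ}
    (ha : Tendsto p atTop (𝓝 a)) (hb : Tendsto p atBot (𝓝 b)) :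
    HasSum (fun n => p (n + 1) - p n) (a - b) := by
  have h1 : HasSum (fun n : ℕ => p ((n : ℤ) + 1) - p n) (a - p 0) := by
    rw [hasSum_iff_tendsto_nat_of_nonneg fun n => sub_nonneg.mpr (hp _)]
    have : ∀ N : ℕ, ∑ n ∈ Finset.range N, (p ((n : ℤ) + 1) - p n) = p N - p 0 := fun N => by
      simpa using Finset.sum_range_sub (fun n : ℕ => p n) N
    simp only [this]
    have hc : Tendsto (fun N : ℕ => p (N : ℤ)) atTop (𝓝 a) := ha.comp tendsto_natCast_atTop_atTop
    exact hc.sub_const _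
  have h2 : HasSum (fun n : ℕ => p (-((n : ℤ) + 1) + 1) - p (-((n : ℤ) + 1))) (p 0 - b) := by
    rw [hasSum_iff_tendsto_nat_of_nonneg fun n => sub_nonneg.mpr (hp _)]
    have : ∀ N : ℕ, ∑ n ∈ Finset.range N, (p (-((n : ℤ) + 1) + 1) - p (-((n : ℤ) + 1))) =
        p 0 - p (-(N : ℤ)) := fun N => by
      have := Finset.sum_range_sub' (fun n : ℕ => p (-(n : ℤ))) N
      simpa using this
    simp only [this]
    have hc : Tendsto (fun N : ℕ => p (-(N : ℤ))) atTop (𝓝 b) :=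
      hb.comp (tendsto_neg_atTop_atBot.comp tendsto_natCast_atTop_atTop)
    exact hc.const_sub _
  have h3 := HasSum.of_nat_of_neg_add_one (f := fun n => p (n + 1) - p n) h1 h2
  rwa [sub_add_sub_cancel] at h3

/-- A refinable Bessel vector whose scale energies exhaust the norm generates a Parseval frame. -/
theorem IsDilationSystem.hasSum_parseval (hT : IsDilationSystem α D T)
    (hχ : IsIndexTwoCharacter α χ) (hh : IsLawtonFilter α S h) (hℓ : ℓ ∉ Set.range α) {φ : H}
    (hφ : IsBesselOne T φ) (hr : refine S h D T φ = φ) {f : H}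
    (htop : Tendsto (fun n : ℤ => ∑' k, ‖inner ℂ (T k φ) ((D ^ (-n)) f)‖ ^ 2) atTop (𝓝 (‖f‖ ^ 2)))
    (hbot : Tendsto (fun n : ℤ => ∑' k, ‖inner ℂ (T k φ) ((D ^ (-n)) f)‖ ^ 2) atBot (𝓝 0)) :
    HasSum (fun p : ℤ × G => ‖inner ℂ ((D ^ p.1) (T p.2 (detail S h χ ℓ D T φ))) f‖ ^ 2)
      (‖f‖ ^ 2) := by
  set P : ℤ → ℝ := fun n => ∑' k, ‖inner ℂ (T k φ) ((D ^ (-n)) f)‖ ^ 2 with hP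
  have hw : ∀ n : ℤ, HasSum
      (fun k => ‖inner ℂ ((D ^ n) (T k (detail S h χ ℓ D T φ))) f‖ ^ 2) (P (n + 1) - P n) := by
    intro n
    simp only [inner_dilation_zpow]
    convert hT.hasSum_detail hχ hh hℓ hφ hr ((D ^ (-n)) f) using 4
    rw [neg_add, add_comm, zpow_add, zpow_neg_one]
    rfl
  have hmono : ∀ n, P n ≤ P (n + 1) := fun n =>
    sub_nonneg.mp ((hw n).nonneg fun _ => by positivity)
  have htel := hasSum_int_telescope hmono htop hbot
  rw [sub_zero] at htel
  have hsum : Summable fun p : ℤ × G =>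
      ‖inner ℂ ((D ^ p.1) (T p.2 (detail S h χ ℓ D T φ))) f‖ ^ 2 := by
    rw [summable_prod_of_nonneg fun _ => by positivity]
    refine ⟨fun n => (hw n).summable, ?_⟩
    simp only [(hw _).tsum_eq]
    exact htel.summable
  have := hsum.hasSum.prod_fiberwise hw
  rw [← this.unique htel]
  exact hsum.hasSum

/-- The analysis operator of a Bessel sequence, as a map into `ℓ²`. -/
noncomputable def analysis {φ : H} (hφ : IsBesselOne T φ) : H →ₗ[ℂ] lp (fun _ : G => ℂ) 2 where
  toFun f := ⟨fun k => inner ℂ (T k φ) f, memℓp_gen (by simpa using hφ.summable f)⟩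
  map_add' f g := by
    ext k
    exact inner_add_right _ _ _
  map_smul' c f := by
    ext k
    exact inner_smul_right _ _ _

theorem norm_analysis_sq {φ : H} (hφ : IsBesselOne T φ) (f : H) :
    ‖analysis hφ f‖ ^ 2 = ∑' k, ‖inner ℂ (T k φ) f‖ ^ 2 := by
  have := lp.norm_rpow_eq_tsum (p := 2) (by norm_num) (analysis hφ f)
  simpa [analysis] using this

theorem norm_analysis_le {φ : H} (hφ : IsBesselOne T φ) (f : H) : ‖analysis hφ f‖ ≤ ‖f‖ := by
  rw [← abs_norm, ← abs_norm f, ← sq_le_sq, norm_analysis_sq]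
  exact hφ.tsum_le f

/-- Convergence of the energies of the coefficients along a sequence of isometries extends from
a dense set to the whole space. -/
theorem IsBesselOne.tendsto_energy_of_dense {φ : H} (hφ : IsBesselOne T φ) {ι : Type*}
    {l : Filter ι} (U : ι → H ≃ₗᵢ[ℂ] H) {Φ : H → ℝ} (hΦ : Continuous Φ) {s : Set H}
    (hs : Dense s) (hconv : ∀ f ∈ s,
      Tendsto (fun i => √(∑' k, ‖inner ℂ (T k φ) (U i f)‖ ^ 2)) l (𝓝 (Φ f))) (f : H) :
    Tendsto (fun i => √(∑' k, ‖inner ℂ (T k φ) (U i f)‖ ^ 2)) l (𝓝 (Φ f)) := by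
  have hsqrt : ∀ g, √(∑' k, ‖inner ℂ (T k φ) g‖ ^ 2) = ‖analysis hφ g‖ := fun g => by
    rw [← norm_analysis_sq, Real.sqrt_sq (norm_nonneg _)]
  simp only [hsqrt] at hconv ⊢
  have hlip : ∀ i, LipschitzWith 1 fun f => ‖analysis hφ (U i f)‖ := fun i => by
    refine LipschitzWith.of_dist_le_mul fun x y => ?_
    rw [Real.dist_eq, NNReal.coe_one, one_mul, dist_eq_norm]
    calc |‖analysis hφ (U i x)‖ - ‖analysis hφ (U i y)‖|
        ≤ ‖analysis hφ (U i x) - analysis hφ (U i y)‖ := abs_norm_sub_norm_le _ _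
      _ = ‖analysis hφ (U i (x - y))‖ := by rw [map_sub, map_sub]
      _ ≤ ‖U i (x - y)‖ := norm_analysis_le _ _
      _ = ‖x - y‖ := (U i).norm_map _
  have hequi : Equicontinuous fun (i : ι) (f : H) => ‖analysis hφ (U i f)‖ :=
    (LipschitzWith.uniformEquicontinuous _ 1 hlip).equicontinuous
  have hcl := hequi.isClosed_setOfPred_tendsto (l := l) hΦ
  exact hcl.closure_subset_iff.mpr (fun g hg => hconv g hg) (hs f)

end Hilbert

section Expansive

/-- Powers of an element of spectral radius less than one decay geometrically. -/
theorem exists_norm_pow_le_of_spectrum {𝔸 : Type*} [NormedRing 𝔸] [NormedAlgebra ℂ 𝔸]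
    [CompleteSpace 𝔸] [Nontrivial 𝔸] (a : 𝔸) (ha : ∀ z ∈ spectrum ℂ a, ‖z‖ < 1) :
    ∃ K θ : ℝ, 0 ≤ K ∧ 0 < θ ∧ θ < 1 ∧ ∀ n : ℕ, ‖a ^ n‖ ≤ K * θ ^ n := by
  have hr : spectralRadius ℂ a < (1 : NNReal) :=
    spectrum.spectralRadius_lt_of_forall_lt a fun z hz => by
      rw [← NNReal.coe_lt_coe]; simpa using ha z hz
  obtain ⟨θ, h1, h2⟩ := ENNReal.lt_iff_exists_nnreal_btwn.mp hr
  have hθ : 0 < θ := by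
    have := (zero_le (a := spectralRadius ℂ a)).trans_lt h1
    simpa using this
  have hθ1 : θ < 1 := by simpa using h2
  have hev := (spectrum.pow_nnnorm_pow_one_div_tendsto_nhds_spectralRadius a).eventually
    (gt_mem_nhds h1)
  have hev' : ∀ᶠ n : ℕ in atTop, ‖a ^ n‖ / (θ : ℝ) ^ n ≤ 1 := by
    filter_upwards [hev, eventually_gt_atTop 0] with n hn hn0
    have hn' : (0 : ℝ) < n := by exact_mod_cast hn0
    have h3 : (‖a ^ n‖₊ : ENNReal) ≤ (θ : ENNReal) ^ n := by
      have h4 := ENNReal.rpow_le_rpow hn.le hn'.le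
      rwa [← ENNReal.rpow_mul, one_div, inv_mul_cancel₀ hn'.ne', ENNReal.rpow_one,
        ENNReal.rpow_natCast] at h4
    have h5 : ‖a ^ n‖₊ ≤ θ ^ n := by exact_mod_cast h3
    rw [div_le_one (by positivity)]
    exact_mod_cast h5
  obtain ⟨K, hK⟩ := (isBoundedUnder_of_eventually_le hev').bddAbove_range
  refine ⟨K, θ, ?_, by exact_mod_cast hθ, by exact_mod_cast hθ1, fun n => ?_⟩
  · exact (by positivity : (0 : ℝ) ≤ ‖a ^ 0‖ / (θ : ℝ) ^ 0).trans (hK ⟨0, rfl⟩)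
  · have := hK ⟨n, rfl⟩
    simp only at this
    rwa [div_le_iff₀ (by positivity)] at this

variable {d : ℕ}

theorem realMat_inv_pow_map (A : Matrix (Fin d) (Fin d) ℤ) (hdet : |A.det| = 2) (n : ℕ) :
    ((A.map fun z => (z : ℂ))⁻¹ ^ n).map Complex.re = (realMat A)⁻¹ ^ n := by
  have h1 : A.map (fun z => (z : ℂ)) = Complex.ofRealHom.mapMatrix (realMat A) := by
    ext i j
    simp [realMat]
  have h2 : (Complex.ofRealHom.mapMatrix (realMat A))⁻¹ =
      Complex.ofRealHom.mapMatrix (realMat A)⁻¹ := by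
    refine Matrix.inv_eq_left_inv ?_
    rw [← map_mul, Matrix.nonsing_inv_mul _ (isUnit_iff_ne_zero.mpr (det_realMat_ne_zero hdet)),
      map_one]
  rw [h1, h2, ← map_pow]
  ext i j
  simp

theorem exists_norm_apply_le {W Y : Type*} [NormedAddCommGroup W] [NormedSpace ℝ W]
    [FiniteDimensional ℝ W] [NormedAddCommGroup Y] [NormedSpace ℝ Y] (L : W →ₗ[ℝ] Y) :
    ∃ c : ℝ, 0 ≤ c ∧ ∀ w, ‖L w‖ ≤ c * ‖w‖ :=
  ⟨_, norm_nonneg _, (LinearMap.toContinuousLinearMap L).le_opNorm⟩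

attribute [local instance] Matrix.linftyOpNormedRing Matrix.linftyOpNormedAlgebra
  Matrix.linftyOpNormedSpace

/-- The inverse powers of an expansive matrix and of its transpose contract geometrically. -/
theorem IsExpansive.exists_contraction {A : Matrix (Fin d) (Fin d) ℤ} (hexp : IsExpansive A)
    (hdet : |A.det| = 2) : ∃ K θ : ℝ, 0 ≤ K ∧ 0 < θ ∧ θ < 1 ∧
      ∀ (n : ℕ) (x : EuclideanSpace ℝ (Fin d)),
        ‖Matrix.toEuclideanLin ((realMat A)⁻¹ ^ n) x‖ ≤ K * θ ^ n * ‖x‖ ∧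
        ‖Matrix.toEuclideanLin ((realMat A).transpose⁻¹ ^ n) x‖ ≤ K * θ ^ n * ‖x‖ := by
  have hne : Nonempty (Fin d) := by
    by_contra h
    rw [not_nonempty_iff] at h
    simp at hdet
  set C : Matrix (Fin d) (Fin d) ℂ := A.map fun z => (z : ℂ) with hC
  have hu : IsUnit C := by
    rw [Matrix.isUnit_iff_isUnit_det, isUnit_iff_ne_zero]
    have : C.det = (A.det : ℂ) := (Int.cast_det A).symm
    rw [this]
    intro h0
    rw [Int.cast_eq_zero.mp h0] at hdet
    norm_num at hdet
  obtain ⟨u, hu⟩ := hu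
  have hspec : ∀ z ∈ spectrum ℂ C⁻¹, ‖z‖ < 1 := by
    intro z hz
    rw [← hu, ← Matrix.coe_units_inv] at hz
    have h1 := hexp _ (by rw [← hC, ← hu]; exact spectrum.inv₀_mem_iff.mpr hz)
    rw [norm_inv] at h1
    by_contra h2
    exact absurd h1 (not_lt.mpr (inv_le_one_of_one_le₀ (not_lt.mp h2)))
  obtain ⟨K, θ, hK, hθ, hθ1, hb⟩ := exists_norm_pow_le_of_spectrum C⁻¹ hspec
  let L₁ : Matrix (Fin d) (Fin d) ℂ →ₗ[ℝ]
      (EuclideanSpace ℝ (Fin d) →L[ℝ] EuclideanSpace ℝ (Fin d)) :=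
    (Matrix.toEuclideanCLM (n := Fin d) (𝕜 := ℝ)).toAlgEquiv.toLinearMap ∘ₗ
      (Complex.reLm.mapMatrix : Matrix (Fin d) (Fin d) ℂ →ₗ[ℝ] Matrix (Fin d) (Fin d) ℝ)
  let L₂ : Matrix (Fin d) (Fin d) ℂ →ₗ[ℝ]
      (EuclideanSpace ℝ (Fin d) →L[ℝ] EuclideanSpace ℝ (Fin d)) :=
    L₁ ∘ₗ (Matrix.transposeLinearEquiv (Fin d) (Fin d) ℝ ℂ).toLinearMap
  obtain ⟨c₁, hc₁, h1⟩ := exists_norm_apply_le L₁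
  obtain ⟨c₂, hc₂, h2⟩ := exists_norm_apply_le L₂
  have hpos : ∀ n : ℕ, 0 ≤ K * θ ^ n := fun n => by positivity
  refine ⟨(c₁ + c₂) * K, θ, by positivity, hθ, hθ1, fun n x => ⟨?_, ?_⟩⟩
  · have e : Matrix.toEuclideanLin ((realMat A)⁻¹ ^ n) x = L₁ (C⁻¹ ^ n) x := by
      rw [← realMat_inv_pow_map A hdet n]
      rfl
    rw [e]
    refine (ContinuousLinearMap.le_opNorm _ _).trans
      (mul_le_mul_of_nonneg_right ?_ (norm_nonneg _))
    refine (h1 _).trans ((mul_le_mul_of_nonneg_left (hb n) hc₁).trans ?_)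
    nlinarith [mul_nonneg hc₂ (hpos n)]
  · have e : Matrix.toEuclideanLin ((realMat A).transpose⁻¹ ^ n) x = L₂ (C⁻¹ ^ n) x := by
      rw [← Matrix.transpose_nonsing_inv, ← Matrix.transpose_pow, ← realMat_inv_pow_map A hdet n]
      rfl
    rw [e]
    refine (ContinuousLinearMap.le_opNorm _ _).trans
      (mul_le_mul_of_nonneg_right ?_ (norm_nonneg _))
    refine (h2 _).trans ((mul_le_mul_of_nonneg_left (hb n) hc₂).trans ?_)
    nlinarith [mul_nonneg hc₁ (hpos n)]

end Expansive

section Filter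

variable {d : ℕ}

theorem inner_latticePoint (n : Fin d → ℤ) (t : EuclideanSpace ℝ (Fin d)) :
    inner ℝ (latticePoint n) t = ∑ i, (n i : ℝ) * t i := by
  simp [latticePoint, PiLp.inner_apply, mul_comm]

theorem filterFun_eq_sum {h : (Fin d → ℤ) → ℂ} {S : Finset (Fin d → ℤ)} (hS : ∀ n ∉ S, h n = 0)
    (t : EuclideanSpace ℝ (Fin d)) : filterFun h t = (1 / (Real.sqrt 2 : ℂ)) *
      ∑ n ∈ S, h n * Complex.exp (-Complex.I * (inner ℝ (latticePoint n) t : ℝ)) := by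
  rw [filterFun, finsum_eq_sum_of_support_subset _ (s := S)]
  · simp only [inner_latticePoint]
  · intro n hn
    by_contra h0
    exact hn (by simp [hS n h0])

theorem continuous_filterFun {h : (Fin d → ℤ) → ℂ} {S : Finset (Fin d → ℤ)}
    (hS : ∀ n ∉ S, h n = 0) : Continuous (filterFun h) := by
  rw [funext (filterFun_eq_sum hS)]
  fun_prop

theorem norm_filterFun_sub_one_le {h : (Fin d → ℤ) → ℂ} {S : Finset (Fin d → ℤ)}
    (hS : ∀ n ∉ S, h n = 0) (hsum : ∑ n ∈ S, h n = (Real.sqrt 2 : ℂ)) :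
    ∃ L : ℝ, 0 ≤ L ∧ ∀ t : EuclideanSpace ℝ (Fin d), ‖filterFun h t - 1‖ ≤ L * ‖t‖ := by
  have h2 : ((Real.sqrt 2 : ℝ) : ℂ) ≠ 0 := by simp
  refine ⟨‖1 / (Real.sqrt 2 : ℂ)‖ * ∑ n ∈ S, ‖h n‖ * ‖latticePoint n‖, by positivity,
    fun t => ?_⟩
  have e : filterFun h t - 1 = (1 / (Real.sqrt 2 : ℂ)) *
      ∑ n ∈ S, h n * (Complex.exp (Complex.I * (-inner ℝ (latticePoint n) t : ℝ)) - 1) := by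
    simp only [mul_sub, Finset.sum_sub_distrib, mul_one, hsum]
    rw [filterFun_eq_sum hS, one_div, inv_mul_cancel₀ h2]
    simp
  rw [e, norm_mul, mul_assoc, Finset.sum_mul]
  refine mul_le_mul_of_nonneg_left ((norm_sum_le _ _).trans (Finset.sum_le_sum fun n _ => ?_))
    (norm_nonneg _)
  rw [norm_mul, mul_assoc]
  refine mul_le_mul_of_nonneg_left (Real.norm_exp_I_mul_ofReal_sub_one_le.trans ?_) (norm_nonneg _)
  rw [norm_neg]
  exact norm_inner_le_norm _ _

/-- The quadrature mirror condition bounds the filter by one. -/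
theorem IsIndexTwoCharacter.norm_filterFun_le {α : (Fin d → ℤ) →+ (Fin d → ℤ)}
    {χ : (Fin d → ℤ) → ℂ} (hχ : IsIndexTwoCharacter α χ) {S : Finset (Fin d → ℤ)}
    {h : (Fin d → ℤ) → ℂ} (hh : IsLawtonFilter α S h) (t : EuclideanSpace ℝ (Fin d)) :
    ‖filterFun h t‖ ≤ 1 := by
  set e : (Fin d → ℤ) → ℂ := fun n => Complex.exp (-Complex.I * (inner ℝ (latticePoint n) t : ℝ))
    with he
  have hX := hχ.sum_autocorrelation hh
    fun u => Complex.exp (Complex.I * (inner ℝ (latticePoint u) t : ℝ))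
  have hsub : ∀ m n : Fin d → ℤ, Complex.exp (Complex.I * (inner ℝ (latticePoint (m - n)) t : ℝ)) =
      conj (e m) * e n := by
    intro m n
    simp only [he]
    rw [← Complex.exp_conj, ← Complex.exp_add]
    congr 1
    simp only [inner_latticePoint, map_mul, _root_.map_neg, Complex.conj_I, Complex.conj_ofReal,
      Pi.sub_apply, Int.cast_sub, sub_mul, Finset.sum_sub_distrib, Complex.ofReal_sub]
    ring
  have hid : ∀ z : ℂ, ((‖z‖ ^ 2 : ℝ) : ℂ) = conj z * z := fun z => by
    rw [mul_comm, Complex.mul_conj, Complex.normSq_eq_norm_sq]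
  have hqmf : ‖∑ n ∈ S, h n * e n‖ ^ 2 + ‖∑ n ∈ S, χ n * h n * e n‖ ^ 2 = 2 := by
    rw [← Complex.ofReal_inj, Complex.ofReal_add, hid, hid, map_sum, map_sum, Finset.sum_mul_sum,
      Finset.sum_mul_sum, ← Finset.sum_add_distrib]
    have h0 : Complex.exp (Complex.I * (inner ℝ (latticePoint (0 : Fin d → ℤ)) t : ℝ)) = 1 := by
      simp [inner_latticePoint]
    rw [h0] at hX
    rw [Complex.ofReal_ofNat, ← mul_one 2, ← hX, Finset.mul_sum]
    refine Finset.sum_congr rfl fun m _ => ?_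
    rw [← Finset.sum_add_distrib, Finset.mul_sum]
    refine Finset.sum_congr rfl fun n _ => ?_
    rw [hsub]
    simp only [map_mul, hχ.conj_eq]
    ring
  rw [filterFun_eq_sum hh.support, norm_mul, norm_div, norm_one, Complex.norm_real,
    Real.norm_of_nonneg (Real.sqrt_nonneg _), one_div, inv_mul_le_iff₀ (by positivity), mul_one]
  refine Real.le_sqrt_of_sq_le ?_
  nlinarith [sq_nonneg ‖∑ n ∈ S, χ n * h n * e n‖]

end Filter

section InfiniteProduct

variable {d : ℕ}

/-- The infinite product `∏ⱼ m₀((A^τ)^{-j} ξ)`. -/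
noncomputable def symbolProd (A : Matrix (Fin d) (Fin d) ℤ) (h : (Fin d → ℤ) → ℂ)
    (ξ : EuclideanSpace ℝ (Fin d)) : ℂ := ∏' j : ℕ, productFactor A h ξ j

/-- The map `(A^τ)^{-n}` on `ℝ^d`. -/
noncomputable abbrev dualContraction (A : Matrix (Fin d) (Fin d) ℤ) (n : ℕ) :
    EuclideanSpace ℝ (Fin d) →ₗ[ℝ] EuclideanSpace ℝ (Fin d) :=
  Matrix.toEuclideanLin ((realMat A).transpose⁻¹ ^ n)

/-- A filter bounded by one, for which the factors of the infinite product converge to one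
geometrically. -/
structure IsContractiveSymbol (A : Matrix (Fin d) (Fin d) ℤ) (h : (Fin d → ℤ) → ℂ)
    (M θ : ℝ) : Prop where
  continuous : Continuous (filterFun h)
  norm_le : ∀ t, ‖filterFun h t‖ ≤ 1
  theta_pos : 0 < θ
  theta_lt : θ < 1
  const_nonneg : 0 ≤ M
  contraction : ∀ n x, ‖dualContraction A n x‖ ≤ M * θ ^ n * ‖x‖
  factor : ∀ ξ j, ‖productFactor A h ξ j - 1‖ ≤ M * θ ^ j * ‖ξ‖

theorem IsExpansive.exists_isContractiveSymbol {A : Matrix (Fin d) (Fin d) ℤ}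
    (hexp : IsExpansive A) (hdet : |A.det| = 2) {α : (Fin d → ℤ) →+ (Fin d → ℤ)}
    {χ : (Fin d → ℤ) → ℂ} (hχ : IsIndexTwoCharacter α χ) {S : Finset (Fin d → ℤ)}
    {h : (Fin d → ℤ) → ℂ} (hh : IsLawtonFilter α S h)
    (hsum : ∑ n ∈ S, h n = (Real.sqrt 2 : ℂ)) :
    ∃ M θ, IsContractiveSymbol A h M θ := by
  obtain ⟨K, θ, hK, hθ, hθ1, hb⟩ := hexp.exists_contraction hdet
  obtain ⟨L, hL, hLip⟩ := norm_filterFun_sub_one_le hh.support hsum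
  refine ⟨K + L * K, θ, continuous_filterFun hh.support, hχ.norm_filterFun_le hh, hθ, hθ1,
    by positivity, fun n x => ((hb n x).2).trans ?_, fun ξ j => ?_⟩
  · have : 0 ≤ L * K * θ ^ n * ‖x‖ := by positivity
    linarith
  · have h1 := (hLip (dualContraction A (j + 1) ξ)).trans
      (mul_le_mul_of_nonneg_left (hb (j + 1) ξ).2 hL)
    refine h1.trans ?_
    have h2 : θ ^ (j + 1) ≤ θ ^ j := pow_le_pow_of_le_one hθ.le hθ1.le (Nat.le_succ j)
    have h3 : L * (K * θ ^ (j + 1) * ‖ξ‖) ≤ L * (K * θ ^ j * ‖ξ‖) := by gcongr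
    have : 0 ≤ K * θ ^ j * ‖ξ‖ := by positivity
    linarith

variable {A : Matrix (Fin d) (Fin d) ℤ} {h : (Fin d → ℤ) → ℂ} {M θ : ℝ}

theorem dualContraction_add (m n : ℕ) (ξ : EuclideanSpace ℝ (Fin d)) :
    dualContraction A (m + n) ξ = dualContraction A m (dualContraction A n ξ) := by
  simp only [dualContraction, pow_add, Matrix.toLpLin_mul_same, LinearMap.comp_apply]

theorem productFactor_add (ξ : EuclideanSpace ℝ (Fin d)) (j n : ℕ) :
    productFactor A h ξ (j + n) = productFactor A h (dualContraction A n ξ) j := by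
  have := dualContraction_add (A := A) (j + 1) n ξ
  simp only [productFactor]
  rw [← this, add_right_comm]

namespace IsContractiveSymbol

variable (hc : IsContractiveSymbol A h M θ)
include hc

theorem summable_norm (ξ : EuclideanSpace ℝ (Fin d)) :
    Summable fun j => ‖productFactor A h ξ j - 1‖ :=
  Summable.of_nonneg_of_le (fun _ => norm_nonneg _) (hc.factor ξ)
    (((summable_geometric_of_lt_one hc.theta_pos.le hc.theta_lt).mul_left M).mul_right _)

theorem multipliable (ξ : EuclideanSpace ℝ (Fin d)) : Multipliable (productFactor A h ξ) := by
  simpa using multipliable_one_add_of_summable (hc.summable_norm ξ)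

theorem tendsto_prod (ξ : EuclideanSpace ℝ (Fin d)) :
    Tendsto (fun k => ∏ j ∈ Finset.range k, productFactor A h ξ j) atTop
      (𝓝 (symbolProd A h ξ)) :=
  (hc.multipliable ξ).hasProd.tendsto_prod_nat

theorem norm_prod_le (ξ : EuclideanSpace ℝ (Fin d)) (k : ℕ) :
    ‖∏ j ∈ Finset.range k, productFactor A h ξ j‖ ≤ 1 := by
  rw [norm_prod]
  exact Finset.prod_le_one (fun _ _ => norm_nonneg _) fun _ _ => hc.norm_le _

theorem norm_symbolProd_le (ξ : EuclideanSpace ℝ (Fin d)) : ‖symbolProd A h ξ‖ ≤ 1 :=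
  le_of_tendsto (hc.tendsto_prod ξ).norm (Eventually.of_forall (hc.norm_prod_le ξ))

theorem continuous_prod (k : ℕ) :
    Continuous fun ξ => ∏ j ∈ Finset.range k, productFactor A h ξ j :=
  continuous_finsetProd _ fun _ _ =>
    hc.continuous.comp (LinearMap.continuous_of_finiteDimensional _)

theorem measurable_symbolProd : Measurable (symbolProd A h) :=
  measurable_of_tendsto_metrizable (fun k => (hc.continuous_prod k).measurable)
    (tendsto_pi_nhds.mpr hc.tendsto_prod)

theorem symbolProd_eq (ξ : EuclideanSpace ℝ (Fin d)) :
    symbolProd A h ξ =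
      filterFun h (dualContraction A 1 ξ) * symbolProd A h (dualContraction A 1 ξ) := by
  have h1 := (hc.tendsto_prod ξ).comp (tendsto_add_atTop_nat 1)
  have h2 := (hc.tendsto_prod (dualContraction A 1 ξ)).const_mul
    (filterFun h (dualContraction A 1 ξ))
  refine tendsto_nhds_unique h1 (h2.congr fun k => ?_)
  simp only [Function.comp, Finset.prod_range_succ', productFactor_add, mul_comm]
  rfl

theorem norm_symbolProd_sub_one_le (ξ : EuclideanSpace ℝ (Fin d)) :
    ‖symbolProd A h ξ - 1‖ ≤ Real.exp (M * (1 - θ)⁻¹ * ‖ξ‖) - 1 := by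
  refine le_of_tendsto ((hc.tendsto_prod ξ).sub_const 1).norm (Eventually.of_forall fun k => ?_)
  have h1 := Finset.norm_prod_one_add_sub_one_le (Finset.range k)
    fun j => productFactor A h ξ j - 1
  simp only [add_sub_cancel] at h1
  refine h1.trans (sub_le_sub_right (Real.exp_le_exp.mpr ?_) 1)
  calc ∑ j ∈ Finset.range k, ‖productFactor A h ξ j - 1‖
      ≤ ∑ j ∈ Finset.range k, M * θ ^ j * ‖ξ‖ := Finset.sum_le_sum fun j _ => hc.factor ξ j
    _ = M * (∑ j ∈ Finset.range k, θ ^ j) * ‖ξ‖ := by rw [Finset.mul_sum, Finset.sum_mul]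
    _ ≤ M * (1 - θ)⁻¹ * ‖ξ‖ := by
        have : ∑ j ∈ Finset.range k, θ ^ j ≤ (1 - θ)⁻¹ := by
          rw [← tsum_geometric_of_lt_one hc.theta_pos.le hc.theta_lt]
          exact (summable_geometric_of_lt_one hc.theta_pos.le hc.theta_lt).sum_le_tsum _
            fun _ _ => pow_nonneg hc.theta_pos.le _
        have := hc.const_nonneg
        gcongr

theorem tendsto_dualContraction (ξ : EuclideanSpace ℝ (Fin d)) :
    Tendsto (fun n => dualContraction A n ξ) atTop (𝓝 0) := by
  refine squeeze_zero_norm (fun n => hc.contraction n ξ) ?_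
  have := ((tendsto_pow_atTop_nhds_zero_of_lt_one hc.theta_pos.le hc.theta_lt).const_mul M).mul_const
    ‖ξ‖
  simpa using this

theorem tendsto_symbolProd {ι : Type*} {l : Filter ι} {u : ι → EuclideanSpace ℝ (Fin d)}
    (hu : Tendsto u l (𝓝 0)) : Tendsto (fun i => symbolProd A h (u i)) l (𝓝 1) := by
  rw [tendsto_iff_norm_sub_tendsto_zero]
  refine squeeze_zero (fun _ => norm_nonneg _) (fun i => hc.norm_symbolProd_sub_one_le (u i)) ?_
  have h1 : Continuous fun x : ℝ => Real.exp (M * (1 - θ)⁻¹ * x) - 1 := by fun_prop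
  have h2 := (h1.tendsto 0).comp (tendsto_zero_iff_norm_tendsto_zero.mp hu)
  simpa [Function.comp_def] using h2

end IsContractiveSymbol

end InfiniteProduct

section FourierOperators

variable {d : ℕ}

/-- The character `w ↦ e^{-2πi x∘w}`. -/
noncomputable def phase (x w : EuclideanSpace ℝ (Fin d)) : ℂ :=
  Complex.exp (((-2 * Real.pi * inner ℝ x w : ℝ) : ℂ) * Complex.I)

theorem norm_phase (x w : EuclideanSpace ℝ (Fin d)) : ‖phase x w‖ = 1 :=
  Complex.norm_exp_ofReal_mul_I _

theorem continuous_phase (x : EuclideanSpace ℝ (Fin d)) : Continuous (phase x) := by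
  unfold phase
  fun_prop

theorem memLp_phase_mul (x : EuclideanSpace ℝ (Fin d)) {f : EuclideanSpace ℝ (Fin d) → ℂ}
    (hf : MemLp f 2) : MemLp (fun w => phase x w * f w) 2 :=
  hf.congr_norm ((continuous_phase x).aestronglyMeasurable.mul hf.aestronglyMeasurable)
    (Eventually.of_forall fun w => by simp [norm_phase])

/-- Multiplication by a character on `L²(ℝ^d)`. -/
noncomputable def modulation (x : EuclideanSpace ℝ (Fin d)) : L2 d →ₗᵢ[ℂ] L2 d where
  toFun f := (memLp_phase_mul x (Lp.memLp f)).toLp _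
  map_add' f g := by
    rw [← MemLp.toLp_add, MemLp.toLp_eq_toLp_iff]
    filter_upwards [Lp.coeFn_add f g] with w hw
    rw [hw]
    exact mul_add _ _ _
  map_smul' c f := by
    rw [RingHom.id_apply, ← MemLp.toLp_const_smul, MemLp.toLp_eq_toLp_iff]
    filter_upwards [Lp.coeFn_smul c f] with w hw
    rw [hw]
    exact mul_left_comm _ _ _
  norm_map' f := by
    change ‖(memLp_phase_mul x (Lp.memLp f)).toLp _‖ = ‖f‖
    rw [Lp.norm_toLp, Lp.norm_def]
    congr 1
    exact eLpNorm_congr_norm_ae (Eventually.of_forall fun w => by simp [norm_phase])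

theorem coeFn_modulation (x : EuclideanSpace ℝ (Fin d)) (f : L2 d) :
    modulation x f =ᵐ[volume] fun w => phase x w * f w :=
  MemLp.coeFn_toLp (memLp_phase_mul x (Lp.memLp f))

theorem coeFn_unitaryDilation (M : Matrix (Fin d) (Fin d) ℝ) (hM : M.det ≠ 0) (f : L2 d) :
    unitaryDilation M hM f =ᵐ[volume] dilationFun M f :=
  MemLp.coeFn_toLp (memLp_dilationFun M hM (Lp.memLp f))

theorem coeFn_unitaryDilation_symm (M : Matrix (Fin d) (Fin d) ℝ) (hM : M.det ≠ 0) (f : L2 d) :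
    (unitaryDilation M hM).symm f =ᵐ[volume] dilationFun M⁻¹ f :=
  MemLp.coeFn_toLp (memLp_dilationFun M⁻¹ (by simpa [Matrix.det_nonsing_inv] using hM) (Lp.memLp f))

theorem coeFn_translation (x : EuclideanSpace ℝ (Fin d)) (f : L2 d) :
    translation x f =ᵐ[volume] fun t => f (t - x) :=
  Lp.coeFn_compMeasurePreserving f (measurePreserving_sub_right volume x)

/-- The Fourier transform on `L²(ℝ^d)` with kernel `e^{-2πi x∘w}`. -/
noncomputable abbrev fourierL2 (d : ℕ) : L2 d ≃ₗᵢ[ℂ] L2 d :=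
  Lp.fourierTransformₗᵢ (EuclideanSpace ℝ (Fin d)) ℂ

theorem fourierL2_toLp (f : 𝓢(EuclideanSpace ℝ (Fin d), ℂ)) :
    fourierL2 d (f.toLp 2) = (𝓕 f).toLp 2 :=
  SchwartzMap.toLp_fourier_eq f

theorem eq_of_eq_schwartz {S T : L2 d → L2 d} (hS : Continuous S) (hT : Continuous T)
    (h : ∀ f : 𝓢(EuclideanSpace ℝ (Fin d), ℂ), S (f.toLp 2) = T (f.toLp 2)) : S = T :=
  (SchwartzMap.denseRange_toLpCLM (E := EuclideanSpace ℝ (Fin d)) (F := ℂ) (p := 2)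
    (μ := volume) ENNReal.ofNat_ne_top).equalizer hS hT (funext h)

theorem fourierL2_translation (x : EuclideanSpace ℝ (Fin d)) (f : L2 d) :
    fourierL2 d (translation x f) = modulation x (fourierL2 d f) := by
  refine congrFun (eq_of_eq_schwartz (S := fun f => fourierL2 d (translation x f))
    (T := fun f => modulation x (fourierL2 d f))
    ((fourierL2 d).continuous.comp (translation x).continuous)
    ((modulation x).continuous.comp (fourierL2 d).continuous) fun f => ?_) f
  have h1 : translation x (f.toLp 2) = (f.compSubConstCLM ℂ x).toLp 2 := by
    refine Lp.ext ?_
    filter_upwards [coeFn_translation x (f.toLp 2), (f.compSubConstCLM ℂ x).coeFn_toLp 2,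
      (measurePreserving_sub_right volume x).quasiMeasurePreserving.ae_eq_comp (f.coeFn_toLp 2)]
      with t h1 h2 h3
    rw [h1, h2, SchwartzMap.compSubConstCLM_apply]
    exact h3
  simp only [h1, fourierL2_toLp]
  refine Lp.ext ?_
  filter_upwards [coeFn_modulation x ((𝓕 f).toLp 2), (𝓕 f).coeFn_toLp 2,
    (𝓕 (f.compSubConstCLM ℂ x)).coeFn_toLp 2] with w h1 h2 h3
  rw [h1, h2, h3, SchwartzMap.fourier_coe, SchwartzMap.fourier_coe, Real.fourier_eq',
    Real.fourier_eq', ← integral_const_mul,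
    ← integral_sub_right_eq_self (fun v => phase x w * _) x]
  refine integral_congr_ae (Eventually.of_forall fun v => ?_)
  simp only [phase, SchwartzMap.compSubConstCLM_apply, smul_eq_mul, ← mul_assoc]
  rw [← Complex.exp_add]
  congr 2
  rw [inner_sub_left]
  push_cast
  ring

theorem det_inv_transpose_ne_zero {M : Matrix (Fin d) (Fin d) ℝ} (hM : M.det ≠ 0) :
    (M.transpose⁻¹).det ≠ 0 := by
  rw [Matrix.det_nonsing_inv, Matrix.det_transpose]
  simpa using hM

theorem inner_toEuclideanLin_transpose (M : Matrix (Fin d) (Fin d) ℝ)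
    (x y : EuclideanSpace ℝ (Fin d)) :
    inner ℝ (Matrix.toEuclideanLin M x) y = inner ℝ x (Matrix.toEuclideanLin M.transpose y) := by
  rw [← Matrix.conjTranspose_eq_transpose_of_trivial,
    Matrix.toEuclideanLin_conjTranspose_eq_adjoint, LinearMap.adjoint_inner_right]

theorem integral_comp_toEuclideanLin (M : Matrix (Fin d) (Fin d) ℝ) (hM : M.det ≠ 0)
    {F : EuclideanSpace ℝ (Fin d) → ℂ} (hF : AEStronglyMeasurable F) :
    ∫ t, F (Matrix.toEuclideanLin M t) = (|M.det|⁻¹ : ℝ) • ∫ t, F t := by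
  have hmap := map_toEuclideanLin M hM
  rw [← integral_map (measurable_toEuclideanLin M).aemeasurable, hmap, integral_smul_measure,
    ENNReal.toReal_ofReal (abs_nonneg _), abs_inv]
  rw [hmap]
  exact hF.smul_measure _

theorem toEuclideanLin_mul_apply (M N : Matrix (Fin d) (Fin d) ℝ)
    (x : EuclideanSpace ℝ (Fin d)) : Matrix.toEuclideanLin M (Matrix.toEuclideanLin N x) =
      Matrix.toEuclideanLin (M * N) x := by
  rw [Matrix.toLpLin_mul_same]
  rfl

/-- Pulling a Schwartz function back along an invertible matrix. -/
theorem exists_schwartz_comp (M : Matrix (Fin d) (Fin d) ℝ) (hM : M.det ≠ 0)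
    (f : 𝓢(EuclideanSpace ℝ (Fin d), ℂ)) :
    ∃ g : 𝓢(EuclideanSpace ℝ (Fin d), ℂ), ∀ t, g t = dilationFun M f t := by
  have hu : IsUnit M.det := isUnit_iff_ne_zero.mpr hM
  let e : EuclideanSpace ℝ (Fin d) ≃ₗ[ℝ] EuclideanSpace ℝ (Fin d) :=
    LinearEquiv.ofLinearMap (Matrix.toEuclideanLin M) (Matrix.toEuclideanLin M⁻¹)
      (by rw [← Matrix.toLpLin_mul_same, Matrix.mul_nonsing_inv _ hu, Matrix.toLpLin_one])
      (by rw [← Matrix.toLpLin_mul_same, Matrix.nonsing_inv_mul _ hu, Matrix.toLpLin_one])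
  exact ⟨(Real.sqrt |M.det| : ℂ) •
    SchwartzMap.compCLMOfContinuousLinearEquiv ℂ e.toContinuousLinearEquiv f, fun t => rfl⟩

theorem fourierL2_unitaryDilation (M : Matrix (Fin d) (Fin d) ℝ) (hM : M.det ≠ 0) (f : L2 d) :
    fourierL2 d (unitaryDilation M hM f) =
      unitaryDilation M.transpose⁻¹ (det_inv_transpose_ne_zero hM) (fourierL2 d f) := by
  have hM' := det_inv_transpose_ne_zero hM
  refine congrFun (eq_of_eq_schwartz (S := fun f => fourierL2 d (unitaryDilation M hM f))
    (T := fun f => unitaryDilation M.transpose⁻¹ hM' (fourierL2 d f))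
    ((fourierL2 d).continuous.comp (unitaryDilation M hM).continuous)
    ((unitaryDilation M.transpose⁻¹ hM').continuous.comp (fourierL2 d).continuous)
    fun f => ?_) f
  obtain ⟨g, hg⟩ := exists_schwartz_comp M hM f
  have h1 : unitaryDilation M hM (f.toLp 2) = g.toLp 2 := by
    refine Lp.ext ?_
    filter_upwards [coeFn_unitaryDilation M hM (f.toLp 2), g.coeFn_toLp 2,
      dilationFun_congr M hM (f.coeFn_toLp 2)] with t h1 h2 h3
    rw [h1, h2, h3, hg]
  simp only [h1, fourierL2_toLp]
  refine Lp.ext ?_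
  filter_upwards [coeFn_unitaryDilation _ hM' ((𝓕 f).toLp 2), (𝓕 g).coeFn_toLp 2,
    dilationFun_congr _ hM' ((𝓕 f).coeFn_toLp 2)] with w h1 h2 h3
  rw [h1, h2, h3, dilationFun, SchwartzMap.fourier_coe, SchwartzMap.fourier_coe, Real.fourier_eq',
    Real.fourier_eq']
  set F : EuclideanSpace ℝ (Fin d) → ℂ := fun v => Complex.exp (((-2 * Real.pi *
    inner ℝ v (Matrix.toEuclideanLin M.transpose⁻¹ w) : ℝ) : ℂ) * Complex.I) • f v with hF
  have hFc : Continuous F := by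
    have := f.continuous
    fun_prop
  have h4 := integral_comp_toEuclideanLin M hM hFc.aestronglyMeasurable
  have h5 : ∀ v, Complex.exp (((-2 * Real.pi * inner ℝ v w : ℝ) : ℂ) * Complex.I) • g v =
      (Real.sqrt |M.det| : ℂ) * F (Matrix.toEuclideanLin M v) := by
    intro v
    simp only [hg, hF, dilationFun]
    rw [inner_toEuclideanLin_transpose, toEuclideanLin_mul_apply,
      Matrix.mul_nonsing_inv _ (by simpa using hM), Matrix.toLpLin_one]
    simp only [smul_eq_mul, LinearMap.id_coe, id_eq]
    ring
  simp only [h5]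
  rw [integral_const_mul, h4, Complex.real_smul, ← mul_assoc]
  congr 1
  rw [Matrix.det_nonsing_inv, Matrix.det_transpose, Ring.inverse_eq_inv', abs_inv, Real.sqrt_inv,
    ← Complex.ofReal_mul]
  congr 1
  have hpos : 0 < Real.sqrt |M.det| := Real.sqrt_pos.mpr (abs_pos.mpr hM)
  have hsq : Real.sqrt |M.det| * Real.sqrt |M.det| = |M.det| := Real.mul_self_sqrt (abs_nonneg _)
  rw [← hsq, mul_inv, ← mul_assoc, hsq, mul_inv_cancel₀ hpos.ne', one_mul]

end FourierOperators

section FourierSeries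

noncomputable local instance unitAddCircleMeasureSpace : MeasureSpace UnitAddCircle :=
  ⟨AddCircle.haarAddCircle⟩

variable {d : ℕ}

/-- The half-open unit cube centred at the origin. -/
def cube (d : ℕ) : Set (EuclideanSpace ℝ (Fin d)) :=
  {w | ∀ i, w i ∈ Set.Ioc (-1 / 2 : ℝ) (-1 / 2 + 1)}

/-- The half-open unit cube in the product space. -/
def piCube (d : ℕ) : Set (Fin d → ℝ) := {x | ∀ i, x i ∈ Set.Ioc (-1 / 2 : ℝ) (-1 / 2 + 1)}

theorem measurableSet_piCube : MeasurableSet (piCube d) :=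
  MeasurableSet.univ_pi' fun _ => measurableSet_Ioc

theorem measurableSet_cube : MeasurableSet (cube d) :=
  (EuclideanSpace.volume_preserving_symm_measurableEquiv_toLp (Fin d)).measurable
    measurableSet_piCube

theorem toLp_preimage_cube :
    (WithLp.toLp 2 : (Fin d → ℝ) → EuclideanSpace ℝ (Fin d)) ⁻¹' cube d = piCube d := rfl

theorem volume_cube : volume (cube d) = 1 := by
  have := (PiLp.volume_preserving_toLp (Fin d)).measure_preimage measurableSet_cube.nullMeasurableSet
  rw [← this, toLp_preimage_cube]
  have h : piCube d = Set.pi Set.univ fun _ => Set.Ioc (-1 / 2 : ℝ) (-1 / 2 + 1) := by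
    ext x; simp [piCube]
  rw [h, Real.volume_pi_Ioc]
  simp

theorem setLIntegral_cube (F : EuclideanSpace ℝ (Fin d) → ENNReal) :
    ∫⁻ x in piCube d, F (WithLp.toLp 2 x) = ∫⁻ w in cube d, F w :=
  (PiLp.volume_preserving_toLp (Fin d)).setLIntegral_comp_preimage_emb
    (MeasurableEquiv.toLp 2 (Fin d → ℝ)).measurableEmbedding F (cube d)

theorem setIntegral_cube {Y : Type*} [NormedAddCommGroup Y] [NormedSpace ℝ Y]
    (F : EuclideanSpace ℝ (Fin d) → Y) :
    ∫ x in piCube d, F (WithLp.toLp 2 x) = ∫ w in cube d, F w :=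
  (PiLp.volume_preserving_toLp (Fin d)).setIntegral_preimage_emb
    (MeasurableEquiv.toLp 2 (Fin d → ℝ)).measurableEmbedding F (cube d)

/-- The representative in the unit cube of a point of the torus. -/
noncomputable def torusSection (x : UnitAddTorus (Fin d)) : EuclideanSpace ℝ (Fin d) :=
  WithLp.toLp 2 fun i => (AddCircle.equivIoc 1 (-1 / 2 : ℝ) (x i) : ℝ)

theorem measurable_torusSection : Measurable (torusSection (d := d)) := by
  refine (MeasurableEquiv.toLp 2 (Fin d → ℝ)).measurable.comp (measurable_pi_lambda _ fun i => ?_)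
  exact measurable_subtype_coe.comp
    ((AddCircle.measurableEquivIoc 1 (-1 / 2 : ℝ)).measurable.comp (measurable_pi_apply i))

theorem torusSection_coe {x : Fin d → ℝ} (hx : x ∈ piCube d) :
    torusSection (fun i => (x i : UnitAddCircle)) = WithLp.toLp 2 x := by
  simp only [torusSection]
  congr 1
  funext i
  rw [AddCircle.equivIoc_coe_of_mem]
  exact hx i

theorem lintegral_torusSection (F : EuclideanSpace ℝ (Fin d) → ENNReal) :
    ∫⁻ x : UnitAddTorus (Fin d), F (torusSection x) = ∫⁻ w in cube d, F w := by
  rw [← setLIntegral_cube]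
  refine (UnitAddTorus.lintegral_preimage (fun x => F (torusSection x))
    (fun _ => (-1 / 2 : ℝ))).trans ?_
  refine setLIntegral_congr_fun measurableSet_piCube fun x hx => ?_
  simp only [torusSection_coe hx]

theorem integral_torusSection {Y : Type*} [NormedAddCommGroup Y] [NormedSpace ℝ Y]
    (F : UnitAddTorus (Fin d) → EuclideanSpace ℝ (Fin d) → Y) :
    ∫ x : UnitAddTorus (Fin d), F x (torusSection x) =
      ∫ w in cube d, F (fun i => (w i : UnitAddCircle)) w := by
  rw [← setIntegral_cube]
  refine (UnitAddTorus.integral_preimage (fun x => F x (torusSection x))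
    (fun _ => (-1 / 2 : ℝ))).trans ?_
  refine setIntegral_congr_fun measurableSet_piCube fun x hx => ?_
  simp only [torusSection_coe hx]

theorem mFourier_coe (n : Fin d → ℤ) (w : EuclideanSpace ℝ (Fin d)) :
    UnitAddTorus.mFourier n (fun i => (w i : UnitAddCircle)) = conj (phase (latticePoint n) w) := by
  simp only [UnitAddTorus.mFourier, ContinuousMap.coe_mk, fourier_coe_apply, phase,
    inner_latticePoint, ← Complex.exp_conj, ← Complex.exp_sum]
  congr 1
  simp only [map_mul, Complex.conj_ofReal, Complex.conj_I]
  push_cast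
  rw [Finset.mul_sum, Finset.sum_mul]
  refine Finset.sum_congr rfl fun i _ => ?_
  ring

/-- The indicator function of the unit cube as an element of `L²(ℝ^d)`. -/
noncomputable def cubeIndicator (d : ℕ) : L2 d :=
  indicatorConstLp 2 (measurableSet_cube (d := d)) (by rw [volume_cube]; exact ENNReal.one_ne_top) 1

theorem coeFn_cubeIndicator :
    cubeIndicator d =ᵐ[volume] (cube d).indicator fun _ => (1 : ℂ) :=
  indicatorConstLp_coeFn

theorem inner_modulation_cubeIndicator (n : Fin d → ℤ) (f : L2 d) :
    inner ℂ (modulation (latticePoint n) (cubeIndicator d)) f =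
      ∫ w in cube d, conj (phase (latticePoint n) w) * f w := by
  rw [L2.inner_def, ← integral_indicator measurableSet_cube]
  refine integral_congr_ae ?_
  filter_upwards [coeFn_modulation (latticePoint n) (cubeIndicator d),
    coeFn_cubeIndicator (d := d)] with w h1 h2
  rw [h1, h2]
  by_cases hw : w ∈ cube d <;> simp [hw, mul_comm]

/-- Parseval's identity for Fourier series on the unit cube. -/
theorem hasSum_inner_modulation_cubeIndicator (f : L2 d) :
    HasSum (fun n : Fin d → ℤ =>
      ‖inner ℂ (modulation (latticePoint n) (cubeIndicator d)) f‖ ^ 2)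
      (∫ w in cube d, ‖f w‖ ^ 2) := by
  set F : UnitAddTorus (Fin d) → ℂ := fun x => f (torusSection x) with hF
  have hFm : Measurable F := (Lp.stronglyMeasurable f).measurable.comp measurable_torusSection
  have hFL : MemLp F 2 (volume : Measure (UnitAddTorus (Fin d))) := by
    refine ⟨hFm.aestronglyMeasurable, ?_⟩
    rw [eLpNorm_lt_top_iff_lintegral_rpow_enorm_lt_top (by norm_num) (by norm_num),
      lintegral_torusSection fun w => ‖f w‖ₑ ^ (2 : ENNReal).toReal]
    refine (setLIntegral_le_lintegral _ _).trans_lt ?_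
    exact (eLpNorm_lt_top_iff_lintegral_rpow_enorm_lt_top (by norm_num) (by norm_num)).mp
      (Lp.memLp f).2
  have hcoeff : ∀ n, UnitAddTorus.mFourierCoeff (hFL.toLp F) n =
      ∫ w in cube d, conj (phase (latticePoint (-n)) w) * f w := by
    intro n
    have h1 : UnitAddTorus.mFourierCoeff (hFL.toLp F) n =
        ∫ x : UnitAddTorus (Fin d), UnitAddTorus.mFourier (-n) x * f (torusSection x) :=
      integral_congr_ae (by
        filter_upwards [hFL.coeFn_toLp] with x hx
        rw [hx, smul_eq_mul])
    rw [h1, integral_torusSection fun x w => UnitAddTorus.mFourier (-n) x * f w]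
    simp only [mFourier_coe]
  have h2 := UnitAddTorus.hasSum_sq_mFourierCoeff (hFL.toLp F)
  have h3 : ∫ x : UnitAddTorus (Fin d), ‖(hFL.toLp F) x‖ ^ 2 = ∫ w in cube d, ‖f w‖ ^ 2 := by
    rw [← integral_torusSection fun _ w => ‖f w‖ ^ 2]
    refine integral_congr_ae ?_
    filter_upwards [hFL.coeFn_toLp] with x hx
    rw [hx]
  rw [h3] at h2
  rw [← (Equiv.neg (Fin d → ℤ)).hasSum_iff]
  refine h2.congr_fun fun n => ?_
  simp only [Function.comp, Equiv.neg_apply, inner_modulation_cubeIndicator, hcoeff]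

theorem ball_subset_cube : Metric.ball (0 : EuclideanSpace ℝ (Fin d)) (1 / 2) ⊆ cube d := by
  intro w hw i
  have h1 := (PiLp.norm_apply_le w i).trans_lt (mem_ball_zero_iff.mp hw)
  rw [Real.norm_eq_abs, abs_lt] at h1
  exact ⟨by linarith [h1.1], by linarith [h1.2]⟩

end FourierSeries

section Lattice

variable {d : ℕ}

/-- The endomorphism `n ↦ A n` of `ℤ^d`. -/
def latticeHom (A : Matrix (Fin d) (Fin d) ℤ) : (Fin d → ℤ) →+ (Fin d → ℤ) :=
  A.mulVecLin.toAddMonoidHom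

theorem latticeHom_apply (A : Matrix (Fin d) (Fin d) ℤ) (n : Fin d → ℤ) :
    latticeHom A n = A.mulVec n := rfl

/-- The translations by lattice vectors. -/
noncomputable abbrev latticeTranslation (d : ℕ) (n : Fin d → ℤ) : L2 d →ₗᵢ[ℂ] L2 d :=
  translation (latticePoint n)

/-- The character `n ↦ (-1)^{q∘n}` of `ℤ^d`. -/
noncomputable abbrev parity (q n : Fin d → ℤ) : ℂ := (-1 : ℂ) ^ (q ⬝ᵥ n)

theorem PartitionProperties.notMem_range {A : Matrix (Fin d) (Fin d) ℤ} {ℓ q : Fin d → ℤ}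
    (hA : PartitionProperties A ℓ q) : ℓ ∉ Set.range (latticeHom A) := fun hℓ =>
  Set.disjoint_left.mp hA.disjoint ⟨0, ⟨0, by simp⟩, by simp⟩ hℓ

theorem PartitionProperties.isIndexTwoCharacter {A : Matrix (Fin d) (Fin d) ℤ} {ℓ q : Fin d → ℤ}
    (hA : PartitionProperties A ℓ q) (hdet : |A.det| = 2) :
    IsIndexTwoCharacter (latticeHom A) (parity q) where
  injective := by
    rw [injective_iff_map_eq_zero]
    intro n hn
    refine Matrix.eq_zero_of_mulVec_eq_zero (fun h0 => ?_) hn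
    rw [h0] at hdet
    norm_num at hdet
  map_add a b := by
    simp only [parity, dotProduct_add]
    exact zpow_add₀ (by norm_num) _ _
  map_range a ha := (hA.even_dot a ha).neg_one_zpow
  map_compl a ha := by
    have h1 : a ∈ (fun x => ℓ + x) '' imageLattice A ∪ imageLattice A := by
      rw [hA.union_eq]; trivial
    exact (hA.odd_dot a (h1.resolve_right ha)).neg_one_zpow

theorem IsFiniteLawtonSolution.isLawtonFilter {A : Matrix (Fin d) (Fin d) ℤ}
    {h : (Fin d → ℤ) → ℂ} (hh : IsFiniteLawtonSolution A h) :
    IsLawtonFilter (latticeHom A) hh.finite_support.toFinset h where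
  support n hn := by simpa using hn
  orthogonality k hk := by
    have h1 := hh.orthogonality k hk
    rw [finsum_eq_sum_of_support_subset (s := hh.finite_support.toFinset)] at h1
    · rw [h1]
      by_cases hk : k = 0 <;> simp [hk]
    · intro n hn
      simp only [Function.mem_support, ne_eq] at hn
      simpa using left_ne_zero_of_mul hn

theorem IsFiniteLawtonSolution.sum_eq {A : Matrix (Fin d) (Fin d) ℤ}
    {h : (Fin d → ℤ) → ℂ} (hh : IsFiniteLawtonSolution A h) :
    ∑ n ∈ hh.finite_support.toFinset, h n = (Real.sqrt 2 : ℂ) := by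
  rw [← hh.normalization, finsum_eq_sum_of_support_subset]
  simp

theorem latticePoint_add (a b : Fin d → ℤ) :
    latticePoint (a + b) = latticePoint a + latticePoint b := by
  ext i
  simp [latticePoint]

theorem toEuclideanLin_latticePoint (A : Matrix (Fin d) (Fin d) ℤ) (n : Fin d → ℤ) :
    Matrix.toEuclideanLin (realMat A) (latticePoint n) = latticePoint (latticeHom A n) := by
  ext i
  simp [latticePoint, realMat, latticeHom_apply, Matrix.mulVec, dotProduct]

theorem coeFn_dilation (A : Matrix (Fin d) (Fin d) ℤ) (hdet : |A.det| = 2) (f : L2 d) :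
    dilation A hdet f =ᵐ[volume] dilationFun (realMat A) f :=
  coeFn_unitaryDilation _ _ f

theorem ae_comp_sub {p : EuclideanSpace ℝ (Fin d) → Prop} (hp : ∀ᵐ t, p t)
    (x : EuclideanSpace ℝ (Fin d)) : ∀ᵐ t, p (t - x) :=
  (measurePreserving_sub_right volume x).quasiMeasurePreserving.ae hp

theorem ae_comp_toEuclideanLin {p : EuclideanSpace ℝ (Fin d) → Prop} (hp : ∀ᵐ t, p t)
    {M : Matrix (Fin d) (Fin d) ℝ} (hM : M.det ≠ 0) :
    ∀ᵐ t, p (Matrix.toEuclideanLin M t) :=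
  (quasiMeasurePreserving_toEuclideanLin M hM).ae hp

theorem isDilationSystem (A : Matrix (Fin d) (Fin d) ℤ) (hdet : |A.det| = 2) :
    IsDilationSystem (latticeHom A) (dilation A hdet) (latticeTranslation d) where
  zero_apply f := by
    refine Lp.ext ?_
    filter_upwards [coeFn_translation (latticePoint 0) f] with t ht
    have : latticePoint (0 : Fin d → ℤ) = 0 := by ext i; simp [latticePoint]
    rw [ht, this, sub_zero]
  add_apply a b f := by
    refine Lp.ext ?_
    filter_upwards [coeFn_translation (latticePoint (a + b)) f,
      coeFn_translation (latticePoint a) (latticeTranslation d b f),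
      ae_comp_sub (coeFn_translation (latticePoint b) f) (latticePoint a)] with t h1 h2 h3
    rw [h1, h2, h3, latticePoint_add, sub_sub]
  comm k f := by
    have hA := det_realMat_ne_zero hdet
    refine Lp.ext ?_
    filter_upwards [coeFn_translation (latticePoint k) (dilation A hdet f),
      ae_comp_sub (coeFn_dilation A hdet f) (latticePoint k),
      coeFn_dilation A hdet (latticeTranslation d (latticeHom A k) f),
      ae_comp_toEuclideanLin (coeFn_translation (latticePoint (latticeHom A k)) f) hA]
      with t h1 h2 h3 h4
    rw [h1, h2, h3, dilationFun, dilationFun, h4, map_sub, toEuclideanLin_latticePoint]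

end Lattice

section Cascade

variable {d : ℕ} {A : Matrix (Fin d) (Fin d) ℤ} (hdet : |A.det| = 2)

include hdet in
theorem sqrt_abs_det_inv_transpose : √|(realMat A).transpose⁻¹.det| = (√2)⁻¹ := by
  have h1 : (realMat A).det = (A.det : ℝ) := (Int.cast_det A).symm
  have h2 : |(A.det : ℝ)| = 2 := by exact_mod_cast hdet
  rw [Matrix.det_nonsing_inv, Matrix.det_transpose, Ring.inverse_eq_inv', h1, abs_inv, h2,
    Real.sqrt_inv]

/-- The two-scale relation on the Fourier side. -/
theorem fourierL2_refine {h : (Fin d → ℤ) → ℂ} {S : Finset (Fin d → ℤ)}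
    (hS : ∀ n ∉ S, h n = 0) (φ : L2 d) :
    fourierL2 d (refine S h (dilation A hdet) (latticeTranslation d) φ) =ᵐ[volume] fun w =>
      filterFun h ((2 * Real.pi) • dualContraction A 1 w) *
        fourierL2 d φ (dualContraction A 1 w) := by
  have hM := det_inv_transpose_ne_zero (det_realMat_ne_zero hdet)
  have h1 : fourierL2 d (refine S h (dilation A hdet) (latticeTranslation d) φ) =
      ∑ n ∈ S, h n • unitaryDilation (realMat A).transpose⁻¹ hM
        (modulation (latticePoint n) (fourierL2 d φ)) := by
    simp only [refine, map_sum, map_smul, dilation, fourierL2_unitaryDilation,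
      fourierL2_translation]
  rw [h1]
  have h2 : ∀ n ∈ S, (h n • unitaryDilation (realMat A).transpose⁻¹ hM
      (modulation (latticePoint n) (fourierL2 d φ)) : L2 d) =ᵐ[volume] fun w =>
        h n * ((√2)⁻¹ * (phase (latticePoint n) (dualContraction A 1 w) *
          fourierL2 d φ (dualContraction A 1 w))) := by
    intro n _
    filter_upwards [Lp.coeFn_smul (h n) (unitaryDilation (realMat A).transpose⁻¹ hM
      (modulation (latticePoint n) (fourierL2 d φ))), coeFn_unitaryDilation _ hM
      (modulation (latticePoint n) (fourierL2 d φ)),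
      ae_comp_toEuclideanLin (coeFn_modulation (latticePoint n) (fourierL2 d φ)) hM] with w h1 h2 h3
    rw [h1, Pi.smul_apply, h2, dilationFun, h3, sqrt_abs_det_inv_transpose hdet, dualContraction,
      pow_one, smul_eq_mul, Complex.ofReal_inv]
  have h3 : ∀ᵐ w, ∀ n ∈ S, (h n • unitaryDilation (realMat A).transpose⁻¹ hM
      (modulation (latticePoint n) (fourierL2 d φ)) : L2 d) w =
        h n * ((√2)⁻¹ * (phase (latticePoint n) (dualContraction A 1 w) *
          fourierL2 d φ (dualContraction A 1 w))) := by
    exact (ae_ball_iff S.countable_toSet).mpr h2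
  filter_upwards [h3, Lp.coeFn_finsetSum S fun n => h n • unitaryDilation (realMat A).transpose⁻¹ hM
      (modulation (latticePoint n) (fourierL2 d φ))] with w hw hsum
  rw [hsum, Finset.sum_apply, Finset.sum_congr rfl hw, filterFun_eq_sum hS, Finset.mul_sum,
    Finset.sum_mul]
  refine Finset.sum_congr rfl fun n _ => ?_
  have : phase (latticePoint n) (dualContraction A 1 w) = Complex.exp (-Complex.I *
      (inner ℝ (latticePoint n) ((2 * Real.pi) • dualContraction A 1 w) : ℝ)) := by
    rw [phase, inner_smul_right]
    congr 1
    push_cast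
    ring
  rw [this, Complex.ofReal_inv, one_div]
  ring

/-- The functions supported in some ball. -/
def boundedSupport (d : ℕ) : Set (L2 d) :=
  {f | ∃ r : ℝ, ∀ᵐ w, r < ‖w‖ → f w = 0}

theorem dense_boundedSupport : Dense (boundedSupport d) := by
  intro f
  refine (mem_closure_iff_nhds_basis Metric.nhds_basis_closedBall).2 fun ε hε => ?_
  obtain ⟨g, hg₁, hg₂, hg₃⟩ := MemLp.exist_eLpNorm_sub_le (p := 2) (by norm_num) (by norm_num)
    (Lp.memLp f) hε
  have hg : MemLp g 2 := hg₂.continuous.memLp_of_hasCompactSupport hg₁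
  refine ⟨hg.toLp g, ?_, ?_⟩
  · obtain ⟨r, hr⟩ := hg₁.isCompact.isBounded.subset_closedBall 0
    refine ⟨r, ?_⟩
    filter_upwards [hg.coeFn_toLp] with w hw hrw
    rw [hw]
    by_contra h0
    have := hr (subset_tsupport g h0)
    rw [mem_closedBall_zero_iff] at this
    linarith
  · rw [Metric.mem_closedBall, dist_comm, Lp.dist_def]
    refine ENNReal.toReal_le_of_le_ofReal hε.le ?_
    refine (eLpNorm_congr_ae ?_).trans_le hg₃
    filter_upwards [hg.coeFn_toLp] with w hw
    simp [hw]

theorem integrable_of_mem_boundedSupport {f : L2 d} (hf : f ∈ boundedSupport d) :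
    Integrable f := by
  obtain ⟨r, hr⟩ := hf
  have h1 : IntegrableOn f (Metric.closedBall 0 r) := by
    have := ((Lp.memLp f).restrict (Metric.closedBall 0 r))
    have hfin : IsFiniteMeasure (volume.restrict (Metric.closedBall (0 : EuclideanSpace ℝ (Fin d)) r)) :=
      ⟨by rw [Measure.restrict_apply_univ]; exact measure_closedBall_lt_top⟩
    exact this.integrable (by norm_num)
  refine (h1.integrable_indicator measurableSet_closedBall).congr ?_
  filter_upwards [hr] with w hw
  by_cases h : ‖w‖ ≤ r
  · rw [Set.indicator_of_mem (mem_closedBall_zero_iff.mpr h)]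
  · rw [Set.indicator_of_notMem (by simpa using h), hw (not_le.mp h)]

theorem dense_preimage_boundedSupport : Dense (fourierL2 d ⁻¹' boundedSupport d) :=
  dense_boundedSupport.preimage (fourierL2 d).toHomeomorph.isOpenMap

theorem inner_latticeTranslation (φ f : L2 d) (n : Fin d → ℤ) :
    inner ℂ (latticeTranslation d n φ) f =
      inner ℂ (modulation (latticePoint n) (fourierL2 d φ)) (fourierL2 d f) := by
  rw [← fourierL2_translation, LinearIsometryEquiv.inner_map_map]

theorem integral_norm_sq_eq (f : L2 d) : ∫ w, ‖f w‖ ^ 2 = ‖f‖ ^ 2 := by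
  rw [← inner_self_eq_norm_sq (𝕜 := ℂ) f, L2.inner_def, ← integral_re (L2.integrable_inner f f)]
  simp only [inner_self_eq_norm_sq]

theorem integrable_norm_sq (f : L2 d) : Integrable fun w => ‖f w‖ ^ 2 :=
  (Lp.memLp f).integrable_norm_pow (by norm_num)

theorem isBesselOne_cubeIndicator :
    IsBesselOne (latticeTranslation d) ((fourierL2 d).symm (cubeIndicator d)) := by
  intro f F
  simp only [inner_latticeTranslation, LinearIsometryEquiv.apply_symm_apply]
  have h1 := hasSum_inner_modulation_cubeIndicator (fourierL2 d f)
  refine (sum_le_hasSum F (fun _ _ => by positivity) h1).trans ?_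
  refine (setIntegral_le_integral (integrable_norm_sq _)
    (Eventually.of_forall fun _ => by positivity)).trans ?_
  rw [integral_norm_sq_eq, LinearIsometryEquiv.norm_map]

theorem IsBesselOne.norm_le {φ : L2 d} (hφ : IsBesselOne (latticeTranslation d) φ) :
    ‖φ‖ ≤ 1 := by
  have h1 := hφ (latticeTranslation d 0 φ) {0}
  rw [Finset.sum_singleton, inner_self_eq_norm_sq_to_K, LinearIsometry.norm_map] at h1
  simp only [norm_pow, RCLike.norm_ofReal, abs_norm] at h1
  by_contra h2
  have h3 : 1 < ‖φ‖ ^ 2 := one_lt_pow₀ (not_le.mp h2) two_ne_zero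
  nlinarith

/-- The iterates of the refinement operator on the function with Fourier transform `1` on the unit
cube. -/
noncomputable def cascade (h : (Fin d → ℤ) → ℂ) (S : Finset (Fin d → ℤ)) (k : ℕ) : L2 d :=
  (refine S h (dilation A hdet) (latticeTranslation d))^[k] ((fourierL2 d).symm (cubeIndicator d))

/-- The Fourier transform of the `k`-th cascade iterate. -/
noncomputable def cascadeSymbol (A : Matrix (Fin d) (Fin d) ℤ) (h : (Fin d → ℤ) → ℂ) (k : ℕ)
    (w : EuclideanSpace ℝ (Fin d)) : ℂ :=
  (∏ j ∈ Finset.range k, productFactor A h ((2 * Real.pi) • w) j) *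
    (cube d).indicator (fun _ => (1 : ℂ)) (dualContraction A k w)

theorem fourierL2_cascade {h : (Fin d → ℤ) → ℂ} {S : Finset (Fin d → ℤ)}
    (hS : ∀ n ∉ S, h n = 0) (k : ℕ) :
    fourierL2 d (cascade hdet h S k) =ᵐ[volume] cascadeSymbol A h k := by
  have hM := det_inv_transpose_ne_zero (det_realMat_ne_zero hdet)
  induction k with
  | zero =>
    rw [cascade, Function.iterate_zero, id, LinearIsometryEquiv.apply_symm_apply]
    filter_upwards [coeFn_cubeIndicator (d := d)] with w hw
    simp [hw, cascadeSymbol]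
  | succ k ih =>
    rw [cascade, Function.iterate_succ_apply', ← cascade]
    filter_upwards [fourierL2_refine hdet hS (cascade hdet h S k),
      ae_comp_toEuclideanLin ih hM] with w h1 h2
    have h3 : Matrix.toEuclideanLin (realMat A).transpose⁻¹ w = dualContraction A 1 w := by
      rw [dualContraction, pow_one]
    rw [h3] at h2
    rw [h1, h2, cascadeSymbol, cascadeSymbol, dualContraction_add, ← mul_assoc,
      Finset.prod_range_succ', mul_comm (filterFun _ _)]
    simp only [productFactor_add, map_smul]
    congr 2
    rw [← map_smul]
    rfl

theorem IsContractiveSymbol.tendsto_cascadeSymbol {h : (Fin d → ℤ) → ℂ} {M θ : ℝ}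
    (hc : IsContractiveSymbol A h M θ) (w : EuclideanSpace ℝ (Fin d)) :
    Tendsto (fun k => cascadeSymbol A h k w) atTop (𝓝 (symbolProd A h ((2 * Real.pi) • w))) := by
  refine (hc.tendsto_prod ((2 * Real.pi) • w)).congr' ?_
  filter_upwards [(hc.tendsto_dualContraction w).eventually
    (Metric.ball_mem_nhds 0 (by norm_num : (0 : ℝ) < 1 / 2))] with k hk
  rw [cascadeSymbol, Set.indicator_of_mem (ball_subset_cube hk), mul_one]

theorem IsContractiveSymbol.norm_cascadeSymbol_le {h : (Fin d → ℤ) → ℂ} {M θ : ℝ}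
    (hc : IsContractiveSymbol A h M θ) (k : ℕ) (w : EuclideanSpace ℝ (Fin d)) :
    ‖cascadeSymbol A h k w‖ ≤ 1 := by
  rw [cascadeSymbol, norm_mul]
  refine mul_le_one₀ (hc.norm_prod_le _ _) (norm_nonneg _) ?_
  refine (norm_indicator_le_norm_self _ _).trans ?_
  simp

theorem isBesselOne_cascade {h : (Fin d → ℤ) → ℂ} {S : Finset (Fin d → ℤ)}
    {χ : (Fin d → ℤ) → ℂ} (hχ : IsIndexTwoCharacter (latticeHom A) χ)
    (hh : IsLawtonFilter (latticeHom A) S h) {ℓ : Fin d → ℤ}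
    (hℓ : ℓ ∉ Set.range (latticeHom A)) (k : ℕ) :
    IsBesselOne (latticeTranslation d) (cascade hdet h S k) := by
  induction k with
  | zero => exact isBesselOne_cubeIndicator
  | succ k ih =>
    rw [cascade, Function.iterate_succ_apply', ← cascade]
    exact (isDilationSystem A hdet).isBesselOne_refine hχ hh hℓ ih

include hdet in
theorem IsContractiveSymbol.memLp {h : (Fin d → ℤ) → ℂ} {M θ : ℝ}
    (hc : IsContractiveSymbol A h M θ) {S : Finset (Fin d → ℤ)}
    {χ : (Fin d → ℤ) → ℂ} (hχ : IsIndexTwoCharacter (latticeHom A) χ)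
    (hh : IsLawtonFilter (latticeHom A) S h) {ℓ : Fin d → ℤ}
    (hℓ : ℓ ∉ Set.range (latticeHom A)) :
    MemLp (fun w => symbolProd A h ((2 * Real.pi) • w)) 2 := by
  have hae := fourierL2_cascade hdet hh.support
  refine ⟨(hc.measurable_symbolProd.comp (by fun_prop)).aestronglyMeasurable, ?_⟩
  have h1 := Lp.eLpNorm_lim_le_liminf_eLpNorm (p := 2)
    (f := fun k => (fourierL2 d (cascade hdet h S k) : EuclideanSpace ℝ (Fin d) → ℂ))
    (fun k => (Lp.aestronglyMeasurable _)) (fun w => symbolProd A h ((2 * Real.pi) • w)) (by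
      filter_upwards [ae_all_iff.mpr hae] with w hw
      simpa only [hw] using hc.tendsto_cascadeSymbol w)
  refine h1.trans_lt (lt_of_le_of_lt ?_ ENNReal.one_lt_top)
  refine liminf_le_of_le (by isBoundedDefault) fun b hb => ?_
  obtain ⟨k, hk⟩ := hb.exists
  refine hk.trans ?_
  have h2 := (isBesselOne_cascade hdet hχ hh hℓ k).norm_le
  rw [← (fourierL2 d).norm_map, Lp.norm_def] at h2
  rw [← ENNReal.ofReal_toReal (Lp.eLpNorm_ne_top (fourierL2 d (cascade hdet h S k))),
    ← ENNReal.ofReal_one]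
  exact ENNReal.ofReal_le_ofReal h2

theorem inner_modulation (n : Fin d → ℤ) (u f : L2 d) :
    inner ℂ (modulation (latticePoint n) u) f = ∫ w, conj (phase (latticePoint n) w * u w) * f w := by
  rw [L2.inner_def]
  refine integral_congr_ae ?_
  filter_upwards [coeFn_modulation (latticePoint n) u] with w hw
  rw [hw, RCLike.inner_apply, mul_comm]

include hdet in
/-- The limit of the cascade iterates has Bessel bound one. -/
theorem IsContractiveSymbol.isBesselOne {h : (Fin d → ℤ) → ℂ} {M θ : ℝ}
    (hc : IsContractiveSymbol A h M θ) {S : Finset (Fin d → ℤ)}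
    {χ : (Fin d → ℤ) → ℂ} (hχ : IsIndexTwoCharacter (latticeHom A) χ)
    (hh : IsLawtonFilter (latticeHom A) S h) {ℓ : Fin d → ℤ}
    (hℓ : ℓ ∉ Set.range (latticeHom A)) {φ : L2 d}
    (hφ : fourierL2 d φ =ᵐ[volume] fun w => symbolProd A h ((2 * Real.pi) • w)) :
    IsBesselOne (latticeTranslation d) φ := by
  intro f F
  have hcl : IsClosed {f : L2 d | ∑ k ∈ F, ‖inner ℂ (latticeTranslation d k φ) f‖ ^ 2 ≤ ‖f‖ ^ 2} :=
    isClosed_le (by fun_prop) (by fun_prop)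
  refine hcl.closure_subset_iff.mpr (fun g hg => ?_) (dense_preimage_boundedSupport f)
  have hint := integrable_of_mem_boundedSupport hg
  have hlim : ∀ n, Tendsto (fun k => inner ℂ (latticeTranslation d n (cascade hdet h S k)) g) atTop
      (𝓝 (inner ℂ (latticeTranslation d n φ) g)) := by
    intro n
    simp only [inner_latticeTranslation, inner_modulation]
    refine tendsto_integral_of_dominated_convergence (fun w => ‖fourierL2 d g w‖) (fun k => ?_)
      hint.norm (fun k => ?_) ?_
    · exact (Complex.continuous_conj.comp_aestronglyMeasurable
        ((continuous_phase _).aestronglyMeasurable.mul (Lp.aestronglyMeasurable _))).mul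
        (Lp.aestronglyMeasurable _)
    · filter_upwards [fourierL2_cascade hdet hh.support k] with w hw
      rw [hw, norm_mul, RCLike.norm_conj, norm_mul, norm_phase, one_mul]
      exact mul_le_of_le_one_left (norm_nonneg _) (hc.norm_cascadeSymbol_le k w)
    · filter_upwards [ae_all_iff.mpr (fourierL2_cascade hdet hh.support), hφ] with w hw hφw
      simp only [hw, hφw]
      refine Tendsto.mul_const _ ?_
      exact (Complex.continuous_conj.tendsto _).comp ((hc.tendsto_cascadeSymbol w).const_mul _)
  refine le_of_tendsto (tendsto_finsetSum F fun n _ => ((hlim n).norm.pow 2))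
    (Eventually.of_forall fun k => ?_)
  exact isBesselOne_cascade hdet hχ hh hℓ k g F

/-- The limit of the cascade iterates is refinable. -/
theorem IsContractiveSymbol.refine_eq {h : (Fin d → ℤ) → ℂ} {M θ : ℝ}
    (hc : IsContractiveSymbol A h M θ) {S : Finset (Fin d → ℤ)} (hS : ∀ n ∉ S, h n = 0) {φ : L2 d}
    (hφ : fourierL2 d φ =ᵐ[volume] fun w => symbolProd A h ((2 * Real.pi) • w)) :
    refine S h (dilation A hdet) (latticeTranslation d) φ = φ := by
  have hM := det_inv_transpose_ne_zero (det_realMat_ne_zero hdet)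
  refine (fourierL2 d).injective (Lp.ext ?_)
  filter_upwards [fourierL2_refine hdet hS φ, ae_comp_toEuclideanLin hφ hM, hφ] with w h1 h2 h3
  have h4 : Matrix.toEuclideanLin (realMat A).transpose⁻¹ w = dualContraction A 1 w := by
    rw [dualContraction, pow_one]
  rw [h4] at h2
  rw [h1, h2, h3, hc.symbolProd_eq ((2 * Real.pi) • w), map_smul]

end Cascade

section Scales

variable {d : ℕ}

theorem dilationFun_dilationFun (M N : Matrix (Fin d) (Fin d) ℝ)
    (f : EuclideanSpace ℝ (Fin d) → ℂ) :
    dilationFun M (dilationFun N f) = dilationFun (N * M) f := by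
  funext t
  simp only [dilationFun, toEuclideanLin_mul_apply, Matrix.det_mul, abs_mul]
  rw [← mul_assoc, ← Complex.ofReal_mul, ← Real.sqrt_mul (abs_nonneg _), mul_comm |M.det|]

theorem pow_succ_apply (W : L2 d ≃ₗᵢ[ℂ] L2 d) (n : ℕ) (f : L2 d) :
    (W ^ (n + 1)) f = W ((W ^ n) f) := by
  rw [pow_succ']
  rfl

theorem coeFn_unitaryDilation_pow (M : Matrix (Fin d) (Fin d) ℝ) (hM : M.det ≠ 0) (n : ℕ)
    (f : L2 d) : (unitaryDilation M hM ^ n) f =ᵐ[volume] dilationFun (M ^ n) f := by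
  induction n with
  | zero =>
    refine Eventually.of_forall fun t => ?_
    simp [dilationFun]
  | succ n ih =>
    rw [pow_succ_apply]
    refine (coeFn_unitaryDilation M hM _).trans ((dilationFun_congr M hM ih).trans ?_)
    rw [dilationFun_dilationFun, ← pow_succ]

theorem det_pow_ne_zero {M : Matrix (Fin d) (Fin d) ℝ} (hM : M.det ≠ 0) (n : ℕ) :
    (M ^ n).det ≠ 0 := by
  rw [Matrix.det_pow]
  exact pow_ne_zero _ hM

theorem unitaryDilation_pow (M : Matrix (Fin d) (Fin d) ℝ) (hM : M.det ≠ 0) (n : ℕ) :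
    unitaryDilation M hM ^ n = unitaryDilation (M ^ n) (det_pow_ne_zero hM n) := by
  refine LinearIsometryEquiv.ext fun f => Lp.ext ?_
  exact (coeFn_unitaryDilation_pow M hM n f).trans (coeFn_unitaryDilation _ _ f).symm

theorem fourierL2_unitaryDilation_pow (M : Matrix (Fin d) (Fin d) ℝ) (hM : M.det ≠ 0) (n : ℕ)
    (f : L2 d) : fourierL2 d ((unitaryDilation M hM ^ n) f) =
      (unitaryDilation M.transpose⁻¹ (det_inv_transpose_ne_zero hM) ^ n) (fourierL2 d f) := by
  induction n with
  | zero => simp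
  | succ n ih =>
    rw [pow_succ_apply, pow_succ_apply, fourierL2_unitaryDilation, ih]

variable {A : Matrix (Fin d) (Fin d) ℤ} (hdet : |A.det| = 2)

/-- If `f` is supported in a ball, then its dilate by the inverse of `M ^ n` is supported in the
image of the ball under `M ^ n`. -/
theorem unitaryDilation_symm_eq_zero {M : Matrix (Fin d) (Fin d) ℝ} (hM : M.det ≠ 0) {f : L2 d}
    {r ε : ℝ} (hf : ∀ᵐ w, r < ‖w‖ → f w = 0)
    (hε : ∀ w, ‖w‖ ≤ r → ‖Matrix.toEuclideanLin M w‖ < ε) :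
    ∀ᵐ w, ε ≤ ‖w‖ → (unitaryDilation M hM).symm f w = 0 := by
  have hM' : M⁻¹.det ≠ 0 := by simpa [Matrix.det_nonsing_inv] using hM
  filter_upwards [coeFn_unitaryDilation_symm M hM f, ae_comp_toEuclideanLin hf hM'] with w h1 h2 h3
  rw [h1, dilationFun, h2, mul_zero]
  by_contra h4
  have h5 := hε _ (not_lt.mp h4)
  rw [toEuclideanLin_mul_apply, Matrix.mul_nonsing_inv _ (isUnit_iff_ne_zero.mpr hM),
    Matrix.toLpLin_one, LinearMap.id_apply] at h5
  linarith

/-- The energies of the coefficients at fine scales exhaust the norm of a band-limited function. -/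
theorem IsContractiveSymbol.tendsto_energy_fine {h : (Fin d → ℤ) → ℂ} {M θ : ℝ}
    (hc : IsContractiveSymbol A h M θ) {φ : L2 d}
    (hφ : fourierL2 d φ =ᵐ[volume] fun w => symbolProd A h ((2 * Real.pi) • w)) {f : L2 d}
    (hf : fourierL2 d f ∈ boundedSupport d) :
    Tendsto (fun n : ℕ => √(∑' k, ‖inner ℂ (latticeTranslation d k φ)
      ((dilation A hdet ^ n).symm f)‖ ^ 2)) atTop (𝓝 ‖f‖) := by
  have hM := det_inv_transpose_ne_zero (det_realMat_ne_zero hdet)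
  set V := unitaryDilation (realMat A).transpose⁻¹ hM with hV
  set u := fourierL2 d f with hu
  set Γ : EuclideanSpace ℝ (Fin d) → ℂ := fun w => symbolProd A h ((2 * Real.pi) • w) with hΓ
  have hΓm : Measurable Γ := hc.measurable_symbolProd.comp (by fun_prop)
  have hΓ1 : ∀ w, ‖Γ w‖ ≤ 1 := fun w => hc.norm_symbolProd_le _
  obtain ⟨r, hr⟩ := hf
  set y : ℕ → L2 d := fun n => (V ^ n).symm u with hy
  have hyf : ∀ n, fourierL2 d ((dilation A hdet ^ n).symm f) = y n := by
    intro n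
    refine (V ^ n).injective ?_
    have e := fourierL2_unitaryDilation_pow _ (det_realMat_ne_zero hdet) n
      ((dilation A hdet ^ n).symm f)
    rw [show unitaryDilation (realMat A) (det_realMat_ne_zero hdet) = dilation A hdet from rfl,
      LinearIsometryEquiv.apply_symm_apply] at e
    rw [hy, LinearIsometryEquiv.apply_symm_apply, hu, e]
  have hzm : ∀ n, MemLp (fun w => conj (Γ w) * y n w) 2 := fun n => by
    refine (Lp.memLp (y n)).of_le ((Complex.continuous_conj.measurable.comp
      hΓm).aestronglyMeasurable.mul (Lp.aestronglyMeasurable _))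
      (Eventually.of_forall fun w => ?_)
    rw [norm_mul, RCLike.norm_conj]
    exact mul_le_of_le_one_left (norm_nonneg _) (hΓ1 w)
  set z : ℕ → L2 d := fun n => (hzm n).toLp _ with hz
  have hzy : ∀ n, z n =ᵐ[volume] fun w => conj (Γ w) * y n w := fun n => (hzm n).coeFn_toLp
  have hsupp : ∀ᶠ n in atTop, ∀ᵐ w, 1 / 2 ≤ ‖w‖ → y n w = 0 := by
    have h1 : Tendsto (fun n => M * θ ^ n * r) atTop (𝓝 0) := by
      have := ((tendsto_pow_atTop_nhds_zero_of_lt_one hc.theta_pos.le hc.theta_lt).const_mul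
        M).mul_const r
      simpa using this
    filter_upwards [h1.eventually (gt_mem_nhds (by norm_num : (0 : ℝ) < 1 / 2))] with n hn
    have e : y n = (unitaryDilation _ (det_pow_ne_zero hM n)).symm u := by
      simp only [hy]
      rw [← unitaryDilation_pow]
    rw [e]
    refine unitaryDilation_symm_eq_zero _ hr fun w hw => ?_
    refine (hc.contraction n w).trans_lt (lt_of_le_of_lt ?_ hn)
    have := hc.const_nonneg
    have := hc.theta_pos
    gcongr
  have hnorm : ∀ n, ‖z n‖ ^ 2 = ∫ w, ‖conj (Γ (dualContraction A n w)) * u w‖ ^ 2 := by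
    intro n
    rw [← (V ^ n).norm_map, ← integral_norm_sq_eq]
    refine integral_congr_ae ?_
    have hMn := det_pow_ne_zero hM n
    have e : (V ^ n) (y n) = u := by rw [hy, LinearIsometryEquiv.apply_symm_apply]
    have h3 := coeFn_unitaryDilation_pow _ hM n (y n)
    rw [← hV, e] at h3
    filter_upwards [coeFn_unitaryDilation_pow _ hM n (z n), ae_comp_toEuclideanLin (hzy n) hMn,
      h3] with w h1 h2 h3
    rw [h1, h3, dilationFun, dilationFun, h2, mul_left_comm]
  have henergy : ∀ᶠ n in atTop, ∑' k, ‖inner ℂ (latticeTranslation d k φ)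
      ((dilation A hdet ^ n).symm f)‖ ^ 2 = ‖z n‖ ^ 2 := by
    filter_upwards [hsupp] with n hn
    have hz0 : ∀ᵐ w, w ∉ cube d → z n w = 0 := by
      filter_upwards [hn, hzy n] with w h1 h2 h3
      rw [h2, h1, mul_zero]
      by_contra h4
      exact h3 (ball_subset_cube (mem_ball_zero_iff.mpr (not_le.mp h4)))
    have h1 : ∀ k, inner ℂ (latticeTranslation d k φ) ((dilation A hdet ^ n).symm f) =
        inner ℂ (modulation (latticePoint k) (cubeIndicator d)) (z n) := by
      intro k
      rw [inner_latticeTranslation, hyf, inner_modulation, inner_modulation_cubeIndicator,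
        ← integral_indicator measurableSet_cube]
      refine integral_congr_ae ?_
      filter_upwards [hφ, hz0, hzy n] with w h1 h2 h3
      by_cases hw : w ∈ cube d
      · rw [Set.indicator_of_mem hw, h1, h3, map_mul]
        ring
      · rw [Set.indicator_of_notMem hw, h1, map_mul, mul_assoc, ← h3, h2 hw, mul_zero]
    simp only [h1]
    rw [(hasSum_inner_modulation_cubeIndicator (z n)).tsum_eq, ← integral_norm_sq_eq,
      ← integral_indicator measurableSet_cube]
    refine integral_congr_ae ?_
    filter_upwards [hz0] with w hw
    by_cases h : w ∈ cube d
    · rw [Set.indicator_of_mem h]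
    · rw [Set.indicator_of_notMem h, hw h]
      simp
  have hlim : Tendsto (fun n => ∫ w, ‖conj (Γ (dualContraction A n w)) * u w‖ ^ 2) atTop
      (𝓝 (∫ w, ‖u w‖ ^ 2)) := by
    refine tendsto_integral_of_dominated_convergence (fun w => ‖u w‖ ^ 2) (fun n => ?_)
      (integrable_norm_sq u) (fun n => Eventually.of_forall fun w => ?_)
      (Eventually.of_forall fun w => ?_)
    · exact (((Complex.continuous_conj.measurable.comp (hΓm.comp
        (measurable_toEuclideanLin _))).aestronglyMeasurable.mul
        (Lp.aestronglyMeasurable _)).norm.pow 2)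
    · rw [Real.norm_of_nonneg (by positivity), norm_mul, RCLike.norm_conj]
      gcongr
      exact mul_le_of_le_one_left (norm_nonneg _) (hΓ1 _)
    · have h1 : Tendsto (fun n => Γ (dualContraction A n w)) atTop (𝓝 1) := by
        refine hc.tendsto_symbolProd ?_
        simpa using (hc.tendsto_dualContraction w).const_smul (2 * Real.pi)
      have h2 := ((Complex.continuous_conj.tendsto _).comp h1).mul_const (u w)
      simpa using h2.norm.pow 2
  have h1 : Tendsto (fun n => ‖z n‖ ^ 2) atTop (𝓝 (‖f‖ ^ 2)) := by
    simp only [hnorm]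
    rw [integral_norm_sq_eq, hu, LinearIsometryEquiv.norm_map] at hlim
    exact hlim
  have h2 := (h1.congr' (henergy.mono fun n hn => hn.symm)).sqrt
  rwa [Real.sqrt_sq (norm_nonneg _)] at h2

/-- The union of the balls of radius `ε` centred at the lattice points. -/
def latticeBalls (d : ℕ) (ε : ℝ) : Set (EuclideanSpace ℝ (Fin d)) :=
  ⋃ k : Fin d → ℤ, Metric.ball (-latticePoint k) ε

theorem one_le_dist_latticePoint {k l : Fin d → ℤ} (hkl : k ≠ l) :
    1 ≤ dist (-latticePoint k) (-latticePoint l) := by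
  obtain ⟨i, hi⟩ := Function.ne_iff.mp hkl
  rw [dist_neg_neg, dist_eq_norm]
  refine le_trans ?_ (PiLp.norm_apply_le (latticePoint k - latticePoint l) i)
  have h1 : (latticePoint k - latticePoint l) i = ((k i - l i : ℤ) : ℝ) := by
    simp [latticePoint]
  rw [h1, Real.norm_eq_abs, ← Int.cast_abs]
  exact_mod_cast Int.one_le_abs (sub_ne_zero.mpr hi)

theorem tendsto_setIntegral_latticeBalls [NeZero d] (φ : L2 d) :
    Tendsto (fun m : ℕ => ∫ w in latticeBalls d (1 / ((m : ℝ) + 2)), ‖φ w‖ ^ 2) atTop (𝓝 0) := by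
  have hanti : Antitone fun m : ℕ => latticeBalls d (1 / ((m : ℝ) + 2)) := by
    intro m n hmn
    refine Set.iUnion_mono fun k => Metric.ball_subset_ball ?_
    have : (m : ℝ) ≤ n := by exact_mod_cast hmn
    gcongr
  have h1 := tendsto_setIntegral_of_antitone (μ := volume) (f := fun w => ‖φ w‖ ^ 2)
    (s := fun m : ℕ => latticeBalls d (1 / ((m : ℝ) + 2)))
    (fun m => MeasurableSet.iUnion fun k => measurableSet_ball) hanti
    ⟨0, (integrable_norm_sq φ).integrableOn⟩
  have hsub : ⋂ m : ℕ, latticeBalls d (1 / ((m : ℝ) + 2)) ⊆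
      Set.range fun k : Fin d → ℤ => -latticePoint k := by
    intro x hx
    simp only [Set.mem_iInter, latticeBalls, Set.mem_iUnion, Metric.mem_ball] at hx
    choose k hk using hx
    have hhalf : ∀ m : ℕ, 1 / ((m : ℝ) + 2) ≤ 1 / 2 := fun m => by
      refine one_div_le_one_div_of_le (by norm_num) ?_
      linarith [Nat.cast_nonneg (α := ℝ) m]
    have hconst : ∀ m, k m = k 0 := by
      intro m
      by_contra hne
      have h2 := one_le_dist_latticePoint hne
      have h3 := dist_triangle_left (-latticePoint (k m)) (-latticePoint (k 0)) x
      linarith [hk m, hk 0, hhalf m, hhalf 0]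
    refine ⟨k 0, ?_⟩
    have h4 : Tendsto (fun m : ℕ => 1 / ((m : ℝ) + 2)) atTop (𝓝 0) :=
      (tendsto_const_nhds (x := (1 : ℝ))).div_atTop
        (tendsto_atTop_add_const_right _ _ tendsto_natCast_atTop_atTop)
    have h5 : dist x (-latticePoint (k 0)) ≤ 0 := ge_of_tendsto h4
      (Eventually.of_forall fun m => by simpa only [hconst m] using (hk m).le)
    exact (dist_le_zero.mp h5).symm
  have hnt : Nontrivial (EuclideanSpace ℝ (Fin d)) := (WithLp.equiv 2 (Fin d → ℝ)).nontrivial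
  have hnull : volume (⋂ m : ℕ, latticeBalls d (1 / ((m : ℝ) + 2))) = 0 :=
    measure_mono_null hsub ((Set.countable_range _).measure_zero _)
  rwa [setIntegral_measure_zero _ hnull] at h1

/-- Coefficients of a function supported in a small ball. -/
theorem sum_inner_translation_le (φ g : L2 d) {ε : ℝ} (hε : ε ≤ 1 / 2)
    (hg : ∀ᵐ t, ε ≤ ‖t‖ → g t = 0) (F : Finset (Fin d → ℤ)) :
    ∑ k ∈ F, ‖inner ℂ (latticeTranslation d k φ) g‖ ^ 2 ≤
      (∫ w in latticeBalls d ε, ‖φ w‖ ^ 2) * ‖g‖ ^ 2 := by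
  have hterm : ∀ k, ‖inner ℂ (latticeTranslation d k φ) g‖ ^ 2 ≤
      (∫ w in Metric.ball (-latticePoint k) ε, ‖φ w‖ ^ 2) * ‖g‖ ^ 2 := by
    intro k
    set B : Set (EuclideanSpace ℝ (Fin d)) := Metric.ball 0 ε
    have hm := (Lp.memLp (latticeTranslation d k φ)).indicator (s := B) measurableSet_ball
    have h1 : inner ℂ (latticeTranslation d k φ) g = inner ℂ (hm.toLp _) g := by
      rw [L2.inner_def, L2.inner_def]
      refine integral_congr_ae ?_
      filter_upwards [hm.coeFn_toLp, hg] with t h1 h2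
      rw [h1]
      by_cases ht : t ∈ B
      · rw [Set.indicator_of_mem ht]
      · rw [h2 (by simpa [B] using ht), inner_zero_right, inner_zero_right]
    have h2 : ‖hm.toLp _‖ ^ 2 = ∫ w in Metric.ball (-latticePoint k) ε, ‖φ w‖ ^ 2 := by
      rw [← integral_norm_sq_eq, ← integral_indicator measurableSet_ball,
        ← integral_sub_right_eq_self (fun w => (Metric.ball (-latticePoint k) ε).indicator
          (fun w => ‖φ w‖ ^ 2) w) (latticePoint k)]
      refine integral_congr_ae ?_
      filter_upwards [hm.coeFn_toLp, coeFn_translation (latticePoint k) φ] with t h1 h2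
      rw [h1]
      by_cases ht : t ∈ B
      · rw [Set.indicator_of_mem ht, Set.indicator_of_mem, h2]
        simpa [B] using ht
      · rw [Set.indicator_of_notMem ht, Set.indicator_of_notMem]
        · simp
        · simpa [B] using ht
    rw [h1, ← h2, ← mul_pow]
    gcongr
    exact norm_inner_le_norm _ _
  refine (Finset.sum_le_sum fun k _ => hterm k).trans ?_
  rw [← Finset.sum_mul]
  refine mul_le_mul_of_nonneg_right ?_ (by positivity)
  rw [← integral_biUnion_finset F (fun _ _ => measurableSet_ball)
    (fun k _ l _ hkl => Metric.ball_disjoint_ball (by linarith [one_le_dist_latticePoint hkl]))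
    fun _ _ => (integrable_norm_sq φ).integrableOn]
  refine setIntegral_mono_set (integrable_norm_sq φ).integrableOn
    (Eventually.of_forall fun _ => by positivity) (LE.le.eventuallyLE ?_)
  exact Set.iUnion₂_subset fun k _ => Set.subset_iUnion (fun k => Metric.ball (-latticePoint k) ε) k

/-- The energies of the coefficients at coarse scales of a function with bounded support vanish
in the limit. -/
theorem IsExpansive.tendsto_energy_coarse (hexp : IsExpansive A) {φ : L2 d} {f : L2 d}
    (hf : f ∈ boundedSupport d) :
    Tendsto (fun n : ℕ => √(∑' k, ‖inner ℂ (latticeTranslation d k φ)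
      ((dilation A hdet ^ n) f)‖ ^ 2)) atTop (𝓝 0) := by
  have hd : NeZero d := ⟨by
    rintro rfl
    simp at hdet⟩
  have hA := det_realMat_ne_zero hdet
  obtain ⟨K, θ, hK, hθ, hθ1, hb⟩ := hexp.exists_contraction hdet
  obtain ⟨r, hr⟩ := hf
  rw [← Real.sqrt_zero]
  refine Tendsto.sqrt ?_
  rw [Metric.tendsto_atTop']
  intro δ hδ
  have h1 : Tendsto (fun m : ℕ => (∫ w in latticeBalls d (1 / ((m : ℝ) + 2)), ‖φ w‖ ^ 2) *
      ‖f‖ ^ 2) atTop (𝓝 0) := by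
    simpa using (tendsto_setIntegral_latticeBalls φ).mul_const (‖f‖ ^ 2)
  obtain ⟨m, hm⟩ := (h1.eventually (gt_mem_nhds hδ)).exists
  have h2 : Tendsto (fun n => K * θ ^ n * r) atTop (𝓝 0) := by
    simpa using ((tendsto_pow_atTop_nhds_zero_of_lt_one hθ.le hθ1).const_mul K).mul_const r
  have hpos : (0 : ℝ) < 1 / ((m : ℝ) + 2) := by positivity
  obtain ⟨N, hN⟩ := eventually_atTop.mp (h2.eventually (gt_mem_nhds hpos))
  refine ⟨N, fun n hn => ?_⟩
  have hsupp : ∀ᵐ t, 1 / ((m : ℝ) + 2) ≤ ‖t‖ → (dilation A hdet ^ n) f t = 0 := by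
    have hAn := det_pow_ne_zero hA n
    filter_upwards [coeFn_unitaryDilation_pow _ hA n f, ae_comp_toEuclideanLin hr hAn]
      with t h3 h4 h5
    rw [dilation, h3, dilationFun, h4, mul_zero]
    by_contra h6
    have h7 := (hb n (Matrix.toEuclideanLin (realMat A ^ n) t)).1
    have h8 : (realMat A)⁻¹ ^ n * realMat A ^ n = 1 := by
      rw [Matrix.inv_pow', Matrix.nonsing_inv_mul _ (isUnit_iff_ne_zero.mpr hAn)]
    rw [toEuclideanLin_mul_apply, h8, Matrix.toLpLin_one, LinearMap.id_apply] at h7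
    have h9 : K * θ ^ n * ‖Matrix.toEuclideanLin (realMat A ^ n) t‖ ≤ K * θ ^ n * r :=
      mul_le_mul_of_nonneg_left (not_lt.mp h6) (by positivity)
    linarith [hN n hn.le]
  have hhalf : 1 / ((m : ℝ) + 2) ≤ 1 / 2 := by
    refine one_div_le_one_div_of_le (by norm_num) ?_
    linarith [Nat.cast_nonneg (α := ℝ) m]
  have hle := Real.tsum_le_of_sum_le (fun _ => by positivity)
    (sum_inner_translation_le φ _ hhalf hsupp)
  rw [LinearIsometryEquiv.norm_map] at hle
  rw [Real.dist_eq, sub_zero, abs_of_nonneg (tsum_nonneg fun _ => by positivity)]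
  exact hle.trans_lt hm

end Scales

section Main

variable {d : ℕ} {A : Matrix (Fin d) (Fin d) ℤ} (hdet : |A.det| = 2)

theorem scalingSymbol_eq_dilationFun (A : Matrix (Fin d) (Fin d) ℤ) (h : (Fin d → ℤ) → ℂ) :
    scalingSymbol A h = dilationFun (((2 * Real.pi)⁻¹ : ℝ) • (1 : Matrix (Fin d) (Fin d) ℝ))
      (fun w => symbolProd A h ((2 * Real.pi) • w)) := by
  have hpi : (0 : ℝ) < 2 * Real.pi := by positivity
  funext ξ
  have h1 : (2 * Real.pi) • Matrix.toEuclideanLin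
      (((2 * Real.pi)⁻¹ : ℝ) • (1 : Matrix (Fin d) (Fin d) ℝ)) ξ = ξ := by
    rw [map_smul, Matrix.toLpLin_one, LinearMap.smul_apply, LinearMap.id_apply, smul_smul,
      mul_inv_cancel₀ hpi.ne', one_smul]
  have h2 : √|(((2 * Real.pi)⁻¹ : ℝ) • (1 : Matrix (Fin d) (Fin d) ℝ)).det| =
      (2 * Real.pi) ^ (-(d : ℝ) / 2) := by
    rw [Matrix.det_smul, Matrix.det_one, mul_one, Fintype.card_fin, abs_of_pos (by positivity),
      Real.sqrt_eq_rpow, inv_pow, ← Real.rpow_natCast, ← Real.rpow_neg hpi.le,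
      ← Real.rpow_mul hpi.le]
    congr 1
    ring
  rw [dilationFun, h1, h2]
  rfl

theorem memLp_scalingSymbol {h : (Fin d → ℤ) → ℂ}
    (hΓ : MemLp (fun w => symbolProd A h ((2 * Real.pi) • w)) 2) :
    MemLp (scalingSymbol A h) 2 := by
  rw [scalingSymbol_eq_dilationFun]
  exact memLp_dilationFun _ (det_scaling_ne_zero d) hΓ

theorem fourierL2_scalingFunction {h : (Fin d → ℤ) → ℂ}
    (hΓ : MemLp (fun w => symbolProd A h ((2 * Real.pi) • w)) 2)
    (hg : MemLp (scalingSymbol A h) 2) :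
    fourierL2 d (scalingFunction A h hg) =ᵐ[volume]
      fun w => symbolProd A h ((2 * Real.pi) • w) := by
  have h1 : scalingFunction A h hg = (fourierL2 d).symm (hΓ.toLp _) := by
    refine (fourierPlancherel d).injective ?_
    rw [scalingFunction, LinearIsometryEquiv.apply_symm_apply, fourierPlancherel,
      LinearIsometryEquiv.trans_apply, LinearIsometryEquiv.apply_symm_apply]
    refine Lp.ext ?_
    refine hg.coeFn_toLp.trans (EventuallyEq.symm ?_)
    rw [scalingSymbol_eq_dilationFun]
    exact (coeFn_unitaryDilation _ (det_scaling_ne_zero d) _).trans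
      (dilationFun_congr _ (det_scaling_ne_zero d) hΓ.coeFn_toLp)
  rw [h1, LinearIsometryEquiv.apply_symm_apply]
  exact hΓ.coeFn_toLp

theorem waveletOf_eq_detail {h : (Fin d → ℤ) → ℂ} {S : Finset (Fin d → ℤ)}
    (hS : ∀ n ∉ S, h n = 0) (ℓ q : Fin d → ℤ) (φ : L2 d) :
    waveletOf A hdet ℓ q h φ =
      detail S h (parity q) ℓ (dilation A hdet) (latticeTranslation d) φ := by
  rw [waveletOf, detail, ← finsum_comp_equiv (Equiv.subLeft ℓ), finsum_eq_sum_of_support_subset _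
    (s := S)]
  · simp only [Equiv.subLeft_apply, sub_sub_cancel]
  · intro n hn
    by_contra h0
    refine hn ?_
    simp [hS n h0]

theorem tendsto_tsum_of_sqrt {G ι : Type*} {l : Filter ι} {a : ι → G → ℝ} {c : ℝ}
    (ha : ∀ i k, 0 ≤ a i k) (hlim : Tendsto (fun i => √(∑' k, a i k)) l (𝓝 c)) :
    Tendsto (fun i => ∑' k, a i k) l (𝓝 (c ^ 2)) := by
  refine (hlim.pow 2).congr fun i => ?_
  rw [Real.sq_sqrt (tsum_nonneg (ha i))]

/-- The wavelet built from a refinable Bessel function whose Fourier transform is the infinite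
product of the filter generates a Parseval frame. -/
theorem IsContractiveSymbol.isParsevalFrameWavelet (hexp : IsExpansive A) {ℓ q : Fin d → ℤ}
    (hA : PartitionProperties A ℓ q) {h : (Fin d → ℤ) → ℂ} {M θ : ℝ}
    (hc : IsContractiveSymbol A h M θ) {S : Finset (Fin d → ℤ)}
    (hh : IsLawtonFilter (latticeHom A) S h) {φ : L2 d}
    (hφ : fourierL2 d φ =ᵐ[volume] fun w => symbolProd A h ((2 * Real.pi) • w)) :
    IsParsevalFrameWavelet A hdet (waveletOf A hdet ℓ q h φ) := by
  have hχ := hA.isIndexTwoCharacter hdet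
  have hb := hc.isBesselOne hdet hχ hh hA.notMem_range hφ
  rw [waveletOf_eq_detail hdet hh.support]
  intro f
  refine (isDilationSystem A hdet).hasSum_parseval hχ hh hA.notMem_range hb
    (hc.refine_eq hdet hh.support hφ) ?_ ?_
  · have h1 := hb.tendsto_energy_of_dense (fun n : ℕ => (dilation A hdet ^ n).symm) continuous_norm
      dense_preimage_boundedSupport (fun g hg => hc.tendsto_energy_fine hdet hφ hg) f
    have h2 := tendsto_tsum_of_sqrt (fun _ _ => by positivity) h1
    rw [← Nat.map_cast_int_atTop, tendsto_map'_iff]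
    refine h2.congr fun n => ?_
    simp only [Function.comp, zpow_neg, zpow_natCast]
    rfl
  · have h1 := hb.tendsto_energy_of_dense (fun n : ℕ => dilation A hdet ^ n)
      (continuous_const (y := (0 : ℝ))) dense_boundedSupport
      (fun g hg => hexp.tendsto_energy_coarse hdet hg) f
    have h2 := tendsto_tsum_of_sqrt (fun _ _ => by positivity) h1
    rw [zero_pow two_ne_zero] at h2
    have h3 : Tendsto (fun n : ℤ => ∑' k, ‖inner ℂ (latticeTranslation d k φ)
        ((dilation A hdet ^ n) f)‖ ^ 2) atTop (𝓝 0) := by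
      rw [← Nat.map_cast_int_atTop, tendsto_map'_iff]
      exact h2.congr fun n => by simp only [Function.comp, zpow_natCast]
    exact h3.comp tendsto_neg_atBot_atTop

end Main

end Wavelet

theorem theorem8p1 (d : ℕ) (A : Matrix (Fin d) (Fin d) ℤ) (hdet : |A.det| = 2)
    (hexp : Wavelet.IsExpansive A) (ℓ q : Fin d → ℤ)
    (hA : Wavelet.PartitionProperties A ℓ q)
    (h : (Fin d → ℤ) → ℂ) (hh : Wavelet.IsFiniteLawtonSolution A h) :
    (∀ ξ : EuclideanSpace ℝ (Fin d), Multipliable (Wavelet.productFactor A h ξ)) ∧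
    ∃ hg : MeasureTheory.MemLp (Wavelet.scalingSymbol A h) 2 MeasureTheory.volume,
      Wavelet.IsParsevalFrameWavelet A hdet
        (Wavelet.waveletOf A hdet ℓ q h (Wavelet.scalingFunction A h hg)) := by
  have hχ := hA.isIndexTwoCharacter hdet
  obtain ⟨M, θ, hc⟩ := hexp.exists_isContractiveSymbol hdet hχ hh.isLawtonFilter hh.sum_eq
  have hΓ := hc.memLp hdet hχ hh.isLawtonFilter hA.notMem_range
  have hg := Wavelet.memLp_scalingSymbol hΓ
  exact ⟨hc.multipliable, hg, hc.isParsevalFrameWavelet hdet hexp hA hh.isLawtonFilter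
    (Wavelet.fourierL2_scalingFunction hΓ hg)⟩
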